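/- Consider partitions $\lambda=(\lambda_1\ge\lambda_2\ge\cdots)$ into positive integers in which every part carries one of two colours, red or green; write $c(\lambda_i)$ for the colour of $\lambda_i$. (Two partitions are the same if they have the same multiset of coloured parts.) For $n,k,\ell,m\ge 0$ let $A_2(n;k,\ell,m)$ be the number of such two-coloured partitions of $n$ having $k$ odd red parts, $\ell$ even red parts and $m$ odd green parts, such that no part is a green $1$ and, for all consecutive parts, $$\lambda_i-\lambda_{i+1}\ \ge\ \begin{cases}1,&\text{if }\lambda_i\text{ is odd and }c(\lambda_i)\ne c(\lambda_{i+1}),\\ 2,&\text{if }\lambda_i\text{ is even and }c(\lambda_i)\neq c(\lambda_{i+1}),\\ 3,&\text{if }\lambda_i\text{ is odd and }c(\lambda_i)=c(\lambda_{i+1}).\end{cases}$$ Let $B_2(n;k,\ell,m)$ be the number of two-coloured partitions of $n$ whose odd parts are distinct and in which only parts congruent to $2$ modulo $4$ may be green, having $k$ parts congruent to $1$ modulo $4$, $\ell$ green parts, and $m$ parts congruent to $3$ modulo $4$. Write $(x;t)_\infty=\prod_{j\ge0}(1-xt^j)$. Then: 1. As formal power series in $q,a,c,d$ (with convergent infinite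 products and an invertible denominator), $$\sum_{n,k,\ell,m\ge0}A_2(n;k,\ell,m)\,q^na^kc^\ell d^m=\frac{(-aq;q^4)_\infty(-dq^3;q^4)_\infty}{(q^2;q^2)_\infty(cq^2;q^4)_\infty}.$$ 2. $A_2(n;k,\ell,m)=B_2(n;k,\ell,m)$ for all $n,k,\ell,m\ge0$. 3. Setting $a=c=d=1$ recovers Primc's identity. Here consider partitions into parts $k_x$ of size $k\ge1$ and colour $x\in\{a,b,c,d\}$, listed in non-increasing order for $1_a<1_b<1_c<1_d<2_a<2_b<\cdots$, such that a part of colour $x$ directly followed by a part of colour $y$ exceeds it in size by at least the entry $(x,y)$ of $$D=\begin{pmatrix}2&1&2&2\\1&0&1&1\\0&1&0&2\\0&1&0&2\end{pmatrix}$$ (rows and columns indexed by $a,b,c,d$). Let $P(n)$ be the number of these for which the dilated parts $k_a\mapsto 2k-1$, $k_b\mapsto 2k$, $k_c\mapsto 2k$, $k_d\mapsto 2k+1$ have sum $n$. Then $\sum_{k,\ell,m\ge0}A_2(n;k,\ell,m)=P(n)$ for every $n\ge0$, and as formal power series in $q$, $$\frac{(-q;q^4)_\infty(-q^3;q^4)_\infty}{(q^2;q^2)_\infty(q^2;q^4)_\infty}=\frac1{(q;q)_\infty},\qquad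 \sum_{n\ge0}P(n)\,q^n=\frac{1}{(q;q)_\infty}.$$ -/

import Mathlib

open scoped MvPowerSeries.WithPiTopology PowerSeries.WithPiTopology

namespace PrimcRefined

/-! ### Coloured partitions -/

/-- A partition into parts coloured by `C`: a finite multiset of coloured positive integers
(a coloured integer is a pair `(size, colour)`). -/
def IsColouredPartition {C : Type} (p : Multiset (ℕ × C)) : Prop :=
  ∀ x ∈ p, 0 < x.1

/-- The integer that a coloured partition partitions: the sum of its parts. -/
def size {C : Type} (p : Multiset (ℕ × C)) : ℕ :=
  (p.map Prod.fst).sum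

/-- There are finitely many partitions of `n` into parts with finitely many colours, so that the
cardinalities below are honest. -/
theorem finite_colouredPartitions {C : Type} [Finite C] (n : ℕ) :
    {p : Multiset (ℕ × C) | IsColouredPartition p ∧ size p = n}.Finite := by
  classical
  have := Fintype.ofFinite C
  refine (Set.finite_Iic
    (n • (Finset.range (n + 1) ×ˢ (Finset.univ : Finset C)).val)).subset ?_
  rintro p ⟨hp, hs⟩
  rw [Set.mem_Iic, Multiset.le_iff_count]
  intro x
  by_cases hx : x ∈ p
  · have h1 : x.1 ≤ n := by
      rw [← hs]
      exact Multiset.single_le_sum (fun _ _ => Nat.zero_le _) _ (Multiset.mem_map_of_mem _ hx)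
    have h2 : p.card ≤ n := by
      have := Multiset.card_nsmul_le_sum (s := p.map Prod.fst) (a := 1) (by
        intro y hy
        obtain ⟨z, hz, rfl⟩ := Multiset.mem_map.1 hy
        exact hp z hz)
      rw [← hs]
      simpa [size] using this
    have h3 : x ∈ (Finset.range (n + 1) ×ˢ (Finset.univ : Finset C)).val := by
      rw [Finset.mem_val, Finset.mem_product]
      exact ⟨Finset.mem_range.2 (by omega), Finset.mem_univ _⟩
    rw [Multiset.count_nsmul,
      Multiset.count_eq_one_of_mem (Finset.nodup _) h3, mul_one]
    exact (Multiset.count_le_card _ _).trans h2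
  · rw [Multiset.count_eq_zero_of_notMem hx]
    exact Nat.zero_le _

/-! ### The two-coloured partitions with difference conditions -/

/-- The two colours. -/
inductive Colour
  | red
  | green
  deriving DecidableEq

/-- The minimal difference required between a part `x` and the next part `y`
(`0` when no condition is imposed). -/
def minGap (x y : ℕ × Colour) : ℕ :=
  if x.2 ≠ y.2 then (if Odd x.1 then 1 else 2)
  else (if Odd x.1 then 3 else 0)

/-- The parts, listed in non-increasing order `λ₁ ≥ λ₂ ≥ ⋯`, satisfy
`λᵢ - λᵢ₊₁ ≥ minGap λᵢ λᵢ₊₁`.  Two parts of equal size and different colours can never be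
neighbours in such a list, so the list is unique and no convention is needed on how to order
equal parts of different colours. -/
def GapCondition (p : Multiset (ℕ × Colour)) : Prop :=
  ∃ l : List (ℕ × Colour), (l : Multiset (ℕ × Colour)) = p ∧
    l.IsChain (fun x y => y.1 ≤ x.1 ∧ y.1 + minGap x y ≤ x.1)

/-- The number of two-coloured partitions of `n` with no green `1` that satisfy the gap
condition and have `k` odd red parts, `l` even red parts and `m` odd green parts. -/
noncomputable def A₂ (n k l m : ℕ) : ℕ :=
  Set.ncard {p : Multiset (ℕ × Colour) |
    IsColouredPartition p ∧ size p = n ∧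
    (1, Colour.green) ∉ p ∧ GapCondition p ∧
    p.countP (fun x => Odd x.1 ∧ x.2 = Colour.red) = k ∧
    p.countP (fun x => Even x.1 ∧ x.2 = Colour.red) = l ∧
    p.countP (fun x => Odd x.1 ∧ x.2 = Colour.green) = m}

/-- The number of two-coloured partitions of `n` whose odd parts are distinct and in which only
parts congruent to `2` modulo `4` may be green, with `k` parts congruent to `1` modulo `4`,
`l` green parts and `m` parts congruent to `3` modulo `4`. -/
noncomputable def B₂ (n k l m : ℕ) : ℕ :=
  Set.ncard {p : Multiset (ℕ × Colour) |
    IsColouredPartition p ∧ size p = n ∧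
    ((p.map Prod.fst).filter (fun s => Odd s)).Nodup ∧
    (∀ x ∈ p, x.2 = Colour.green → x.1 % 4 = 2) ∧
    p.countP (fun x => x.1 % 4 = 1) = k ∧
    p.countP (fun x => x.2 = Colour.green) = l ∧
    p.countP (fun x => x.1 % 4 = 3) = m}

/-! ### Primc's four-coloured partitions

The colours `a, b, c, d` are `0, 1, 2, 3 : Fin 4`. -/

/-- The matrix of difference conditions: the entry `(x, y)` is the minimal difference between
a part of colour `x` and the next part, of colour `y`. -/
def primcMatrix : Matrix (Fin 4) (Fin 4) ℕ :=
  !![2, 1, 2, 2;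
     1, 0, 1, 1;
     0, 1, 0, 2;
     0, 1, 0, 2]

/-- The parts, listed in non-increasing order for `1_a < 1_b < 1_c < 1_d < 2_a < 2_b < ⋯`,
satisfy the difference conditions of `primcMatrix`. -/
def PrimcCondition (p : Multiset (ℕ × Fin 4)) : Prop :=
  ∃ l : List (ℕ × Fin 4), (l : Multiset (ℕ × Fin 4)) = p ∧
    l.IsChain (fun x y =>
      (y.1 < x.1 ∨ (y.1 = x.1 ∧ y.2 ≤ x.2)) ∧ y.1 + primcMatrix x.2 y.2 ≤ x.1)

/-- The dilation `k_a ↦ 2k - 1`, `k_b ↦ 2k`, `k_c ↦ 2k`, `k_d ↦ 2k + 1`. -/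
def primcDilation (x : ℕ × Fin 4) : ℕ :=
  ![2 * x.1 - 1, 2 * x.1, 2 * x.1, 2 * x.1 + 1] x.2

/-- The number of four-coloured partitions satisfying Primc's difference conditions whose
dilated parts sum to `n`. -/
noncomputable def primcCount (n : ℕ) : ℕ :=
  Set.ncard {p : Multiset (ℕ × Fin 4) |
    IsColouredPartition p ∧ PrimcCondition p ∧ (p.map primcDilation).sum = n}

/-! ### Generating functions -/

/-- The factors of `(x; t)_∞ = ∏_{j ≥ 0} (1 - x t^j)` form a convergent infinite product. -/
def QPochhammerConverges {R : Type} [CommRing R] [TopologicalSpace R] (x t : R) : Prop :=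
  Multipliable (fun j : ℕ => 1 - x * t ^ j)

/-- `(x; t)_∞ = ∏_{j ≥ 0} (1 - x t^j)`. -/
noncomputable def qPochhammer {R : Type} [CommRing R] [TopologicalSpace R] (x t : R) : R :=
  ∏' j : ℕ, (1 - x * t ^ j)

/-- The four formal variables. -/
inductive Var
  | q
  | a
  | c
  | d
  deriving DecidableEq

/-- The formal variables as power series in `ℤ⟦q, a, c, d⟧`. -/
noncomputable def var (v : Var) : MvPowerSeries Var ℤ := MvPowerSeries.X v

/-- The formal power series `∑ F(n; k, l, m) q^n a^k c^l d^m`. -/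
def genFun (F : ℕ → ℕ → ℕ → ℕ → ℕ) : MvPowerSeries Var ℤ :=
  fun e => (F (e Var.q) (e Var.a) (e Var.c) (e Var.d) : ℤ)

end PrimcRefined

open PrimcRefined

/-! Write `Q = q ^ 2`. Dilation turns Primc's four-coloured partitions into the two-coloured ones:
the colours `a, b, c, d` become odd red, even green, even red and odd green, and the matrix entries
become the gap conditions (`minGap_dilate`). So `A₂` and `primcCount` are both read off one weighted
set, `primcLists`. Weights are taken along an arbitrary `ε`, with `ε q ≠ 0` as the only requirement,
so that the four-variable series and its value at `a = c = d = 1` are two instances of one argument.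

Removing the first part of a list gives recurrences in the size of the largest part. Since colours
`c` and `d` allow the same continuations, and `(k+1)_a` allows the same ones as `k_b`, two sequences
`γ` and `T` suffice (`largestPartRecurrence_primc`). The recurrences determine `γ`, and they are
solved by factored generating functions: `∑ γ_N X^N = E(X) K(X)` and `∑ T_N X^N = X E(X) S(X)`. Here
`E(X) = (1 + X) E(QX)` is Euler's series for `(-X; Q)_∞`, while `K` and `S` are series in `X ^ 2`
with first-order recursive coefficients (`largestPartRecurrence_coeff`). The coefficients of `K` are
quotients of finite products, and letting `N → ∞` yields `(-Q; Q)_∞ lim k_n`, which is the claimed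
product because `(Q; Q)_∞ (-Q; Q)_∞ = (q^4; q^4)_∞` (`LargestPartRecurrence.limit`).

For `B₂` the same product arises by admitting the part sizes four at a time
(`congruencePartitions_genFun`). Equality of the counts is then equality of coefficients. -/

namespace PrimcRefined

open Filter Topology Finset

/-! ### Limits, infinite products and Euler's identity for formal power series -/

section FormalLimits

variable {σ : Type}

/-- The ideal of power series whose coefficients vanish at all exponents below `e`. -/
def vanishingIdeal (e : σ →₀ ℕ) : Ideal (MvPowerSeries σ ℤ) where
  carrier := {f | ∀ e' ≤ e, MvPowerSeries.coeff e' f = 0}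
  add_mem' hf hg e' he := by rw [map_add, hf e' he, hg e' he, add_zero]
  zero_mem' _ _ := map_zero _
  smul_mem' c f hf e' he := by
    classical
    rw [smul_eq_mul, MvPowerSeries.coeff_mul]
    refine Finset.sum_eq_zero fun x hx => ?_
    rw [hf x.2 ((Finset.HasAntidiagonal.antidiagonal.snd_le hx).trans he), mul_zero]

theorem mem_vanishingIdeal {e : σ →₀ ℕ} {f : MvPowerSeries σ ℤ} :
    f ∈ vanishingIdeal e ↔ ∀ e' ≤ e, MvPowerSeries.coeff e' f = 0 := Iff.rfl

theorem tendsto_zero_iff_vanishingIdeal {ι : Type*} {l : Filter ι} {f : ι → MvPowerSeries σ ℤ} :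
    Tendsto f l (𝓝 0) ↔ ∀ e, ∀ᶠ i in l, f i ∈ vanishingIdeal e := by
  classical
  rw [MvPowerSeries.WithPiTopology.tendsto_iff_coeff_tendsto]
  simp only [map_zero, nhds_discrete, tendsto_pure]
  constructor
  · intro h e
    have := (Finset.eventually_all (Finset.Iic e)).2 fun e' _ => h e'
    filter_upwards [this] with i hi e' he
    exact hi e' (Finset.mem_Iic.2 he)
  · intro h e
    filter_upwards [h e] with i hi
    exact hi e le_rfl

theorem tendsto_iff_sub_mem_vanishingIdeal {ι : Type*} {l : Filter ι}
    {f : ι → MvPowerSeries σ ℤ} {g : MvPowerSeries σ ℤ} :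
    Tendsto f l (𝓝 g) ↔ ∀ e, ∀ᶠ i in l, f i - g ∈ vanishingIdeal e := by
  rw [← tendsto_zero_iff_vanishingIdeal, tendsto_sub_nhds_zero_iff]

/-- Convergence to zero means eventual membership in every vanishing ideal, and a unit factor does
not affect membership in an ideal. Limits of quotients therefore need no continuity of inversion. -/
theorem tendsto_of_isUnit_mul {ι : Type*} {l : Filter ι} {u x : ι → MvPowerSeries σ ℤ}
    {u' v : MvPowerSeries σ ℤ} (hu : ∀ i, IsUnit (u i)) (hu' : Tendsto u l (𝓝 u'))
    (hux : Tendsto (fun i => u i * x i) l (𝓝 (u' * v))) : Tendsto x l (𝓝 v) := by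
  rw [tendsto_iff_sub_mem_vanishingIdeal]
  intro e
  have h : Tendsto (fun i => u i * (x i - v)) l (𝓝 0) := by
    have := hux.sub (hu'.mul_const v)
    rw [sub_self] at this
    simpa only [mul_sub] using this
  filter_upwards [tendsto_zero_iff_vanishingIdeal.1 h e] with i hi
  exact ((vanishingIdeal e).unit_mul_mem_iff_mem (hu i)).1 hi

/-- A Cauchy product behaves like the partial sums of `f` times `κ`. In the error terms `f m * (k j
- κ)` with `m + j` large, either `m` is large and the first factor is negligible, or `j` is large
and the second one is. -/
theorem tendsto_sum_antidiagonal {f k : ℕ → MvPowerSeries σ ℤ} {s κ : MvPowerSeries σ ℤ}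
    (hf : HasSum f s) (hk : Tendsto k atTop (𝓝 κ)) :
    Tendsto (fun N => ∑ x ∈ antidiagonal N, f x.1 * k x.2) atTop (𝓝 (s * κ)) := by
  have h1 : Tendsto (fun N => (∑ m ∈ range (N + 1), f m) * κ) atTop (𝓝 (s * κ)) :=
    (hf.tendsto_sum_nat.comp (tendsto_add_atTop_nat 1)).mul_const κ
  have h2 : Tendsto (fun N => ∑ x ∈ antidiagonal N, f x.1 * (k x.2 - κ)) atTop (𝓝 0) := by
    rw [tendsto_zero_iff_vanishingIdeal]
    intro e
    obtain ⟨M, hM⟩ := eventually_atTop.1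
      (tendsto_zero_iff_vanishingIdeal.1 hf.summable.tendsto_atTop_zero e)
    obtain ⟨J, hJ⟩ := eventually_atTop.1 (tendsto_iff_sub_mem_vanishingIdeal.1 hk e)
    filter_upwards [eventually_ge_atTop (M + J)] with N hN
    refine Ideal.sum_mem _ fun x hx => ?_
    rw [HasAntidiagonal.mem_antidiagonal] at hx
    rcases le_or_gt M x.1 with h | h
    · exact Ideal.mul_mem_right _ _ (hM _ h)
    · exact Ideal.mul_mem_left _ _ (hJ _ (by omega))
  have := h1.add h2
  rw [add_zero] at this
  refine this.congr fun N => ?_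
  rw [← Finset.Nat.sum_antidiagonal_eq_sum_range_succ (fun m _ => f m), Finset.sum_mul,
    ← Finset.sum_add_distrib]
  exact Finset.sum_congr rfl fun x _ => by ring

theorem natCast_le_order_mul_pow (x : MvPowerSeries σ ℤ) {t : MvPowerSeries σ ℤ}
    (ht : MvPowerSeries.constantCoeff t = 0) (j : ℕ) : (j : ℕ∞) ≤ (x * t ^ j).order :=
  (MvPowerSeries.le_order_pow_of_constantCoeff_eq_zero j ht).trans
    (le_add_self.trans MvPowerSeries.le_order_mul)

theorem tendsto_order_mul_pow (x : MvPowerSeries σ ℤ) {t : MvPowerSeries σ ℤ}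
    (ht : MvPowerSeries.constantCoeff t = 0) :
    Tendsto (fun j : ℕ => (x * t ^ j).order) atTop (𝓝 ⊤) := by
  rw [ENat.tendsto_nhds_top_iff_natCast_lt]
  intro n
  filter_upwards [eventually_gt_atTop n] with j hj
  exact lt_of_lt_of_le (by exact_mod_cast hj) (natCast_le_order_mul_pow x ht j)

theorem qPochhammerConverges_of_constantCoeff (x : MvPowerSeries σ ℤ) {t : MvPowerSeries σ ℤ}
    (ht : MvPowerSeries.constantCoeff t = 0) : QPochhammerConverges x t := by
  have := MvPowerSeries.WithPiTopology.multipliable_one_add_of_tendsto_order_atTop_nhds_top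
    (f := fun j => -x * t ^ j) (tendsto_order_mul_pow (-x) ht)
  refine this.congr fun j => ?_
  ring

theorem isUnit_one_sub {f : MvPowerSeries σ ℤ} (hf : MvPowerSeries.constantCoeff f = 0) :
    IsUnit (1 - f) := by
  rw [MvPowerSeries.isUnit_iff_constantCoeff, map_sub, map_one, hf, sub_zero]
  exact isUnit_one

theorem isUnit_qPochhammer {x t : MvPowerSeries σ ℤ} (hx : MvPowerSeries.constantCoeff x = 0)
    (ht : MvPowerSeries.constantCoeff t = 0) : IsUnit (qPochhammer x t) := by
  rw [MvPowerSeries.isUnit_iff_constantCoeff, qPochhammer,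
    (qPochhammerConverges_of_constantCoeff x ht).map_tprod
      (MvPowerSeries.constantCoeff (σ := σ) (R := ℤ))
      (MvPowerSeries.WithPiTopology.continuous_constantCoeff ℤ)]
  simp [hx]

theorem tendsto_prod_qPochhammer (x : MvPowerSeries σ ℤ) {t : MvPowerSeries σ ℤ}
    (ht : MvPowerSeries.constantCoeff t = 0) :
    Tendsto (fun n => ∏ j ∈ range n, (1 - x * t ^ j)) atTop (𝓝 (qPochhammer x t)) :=
  (qPochhammerConverges_of_constantCoeff x ht).tendsto_prod_tprod_nat

theorem summable_mul_pow (e : ℕ → MvPowerSeries σ ℤ) {t : MvPowerSeries σ ℤ}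
    (ht : MvPowerSeries.constantCoeff t = 0) : Summable fun m => e m * t ^ m := by
  apply MvPowerSeries.WithPiTopology.summable_of_tendsto_order_atTop_nhds_top
  rw [ENat.tendsto_nhds_top_iff_natCast_lt]
  intro n
  filter_upwards [eventually_gt_atTop n] with j hj
  exact lt_of_lt_of_le (by exact_mod_cast hj) (natCast_le_order_mul_pow (e j) ht j)

/-- Euler's summation of `(-Q; Q)_∞`. -/
theorem tsum_mul_pow_eq_qPochhammer {e : ℕ → MvPowerSeries σ ℤ} {Q : MvPowerSeries σ ℤ}
    (hQ : MvPowerSeries.constantCoeff Q = 0) (h0 : e 0 = 1)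
    (he : ∀ m, e (m + 1) = Q ^ (m + 1) * e (m + 1) + Q ^ m * e m) :
    ∑' m, e m * Q ^ m = qPochhammer (-Q) Q := by
  have hc : ∀ j, MvPowerSeries.constantCoeff (Q ^ (j + 1)) = 0 := fun j => by
    rw [map_pow, hQ, zero_pow j.succ_ne_zero]
  -- These are the values `E(Q^(j+1))` of `E(x) = ∑ e_m x^m`. The recursion for `e` says `E(x) = (1
  -- + x) E(Q x)`, so iterating peels off the factors of the product, while `E(Q^(j+1))` tends to
  -- `E(0) = 1`.
  set s : ℕ → MvPowerSeries σ ℤ := fun j => ∑' m, e m * (Q ^ (j + 1)) ^ m with hs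
  have hsplit : ∀ j, s j = 1 + ∑' m, e (m + 1) * (Q ^ (j + 1)) ^ (m + 1) := fun j => by
    rw [hs]
    simp only
    rw [(summable_mul_pow e (hc j)).tsum_eq_zero_add, h0, pow_zero, one_mul]
  have hstep : ∀ j, s j = (1 + Q ^ (j + 1)) * s (j + 1) := fun j => by
    have h1 : (fun m => e (m + 1) * (Q ^ (j + 1)) ^ (m + 1)) = fun m =>
        e (m + 1) * (Q ^ (j + 1 + 1)) ^ (m + 1) +
          Q ^ (j + 1) * (e m * (Q ^ (j + 1 + 1)) ^ m) := by
      funext m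
      conv_lhs => rw [he m]
      ring
    rw [hsplit j, h1, Summable.tsum_add
      ((summable_nat_add_iff 1).2 (summable_mul_pow e (hc (j + 1))))
      ((summable_mul_pow e (hc (j + 1))).mul_left _),
      (summable_mul_pow e (hc (j + 1))).tsum_mul_left, ← add_assoc, ← hsplit]
    ring
  have hprod : ∀ n, s 0 = (∏ j ∈ range n, (1 - -Q * Q ^ j)) * s n := fun n => by
    induction n with
    | zero => simp
    | succ n ih =>
      rw [ih, hstep n, Finset.prod_range_succ]
      ring
  have hlim : Tendsto s atTop (𝓝 1) := by
    rw [tendsto_iff_sub_mem_vanishingIdeal]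
    intro e'
    have hp : Tendsto (fun n => Q ^ (n + 1)) atTop (𝓝 0) :=
      (MvPowerSeries.WithPiTopology.summable_pow_of_constantCoeff_eq_zero
        hQ).tendsto_atTop_zero.comp (tendsto_add_atTop_nat 1)
    filter_upwards [tendsto_zero_iff_vanishingIdeal.1 hp e'] with n hn
    have h1 : (fun m => e (m + 1) * (Q ^ (n + 1)) ^ (m + 1)) = fun m =>
        Q ^ (n + 1) * (e (m + 1) * (Q ^ (n + 1)) ^ m) := by
      funext m
      ring
    rw [hsplit n, add_sub_cancel_left, h1,
      (summable_mul_pow (fun m => e (m + 1)) (hc n)).tsum_mul_left]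
    exact Ideal.mul_mem_right _ _ hn
  have h0' : s 0 = ∑' m, e m * Q ^ m := by simp [hs]
  rw [← h0']
  have := (tendsto_prod_qPochhammer (-Q) hQ).mul hlim
  rw [mul_one] at this
  exact tendsto_nhds_unique (tendsto_const_nhds.congr hprod) this

end FormalLimits

end PrimcRefined

namespace PrimcRefined

open Filter Topology Finset

/-! ### The largest-part recurrences and their factored solution -/

section Recurrence

variable {R : Type} [CommRing R]

/-- The power series `∑ kₙ X^{2n}`. -/
def evenSeries (k : ℕ → R) : PowerSeries R :=
  PowerSeries.mk fun n => if Even n then k (n / 2) else 0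

/-- A pair of sequences satisfying the recurrences of the largest-part generating functions. -/
structure LargestPartRecurrence (q a c d : R) (γ T : ℕ → R) : Prop where
  zero_left : γ 0 = 1
  one_left : (1 - q ^ 2) * γ 1 = 1
  zero_right : T 0 = 0
  left : ∀ k, (1 - (q ^ 2) ^ (k + 2)) * γ (k + 2) =
    γ (k + 1) + a * q * (q ^ 2) ^ k * γ k + (c + d * q) * (q ^ 2) ^ (k + 1) * T (k + 1)
  right : ∀ k, (1 - c * (q ^ 2) ^ (k + 1)) * T (k + 1) =
    a * q * (q ^ 2) ^ k * γ k + (1 - (q ^ 2) ^ (k + 1)) * γ (k + 1) - d * q * (q ^ 2) ^ k * T k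

/-- The recurrence for `γ` has order two and that for `T` order one, so the induction carries two
consecutive values of `γ` and one of `T`; each new value comes with a unit coefficient. -/
theorem LargestPartRecurrence.unique {q a c d : R} {γ T γ' T' : ℕ → R}
    (h : LargestPartRecurrence q a c d γ T) (h' : LargestPartRecurrence q a c d γ' T')
    (hu : ∀ k, IsUnit (1 - (q ^ 2) ^ (k + 1))) (hc : ∀ k, IsUnit (1 - c * (q ^ 2) ^ (k + 1))) :
    γ = γ' := by
  have key : ∀ k, γ k = γ' k ∧ γ (k + 1) = γ' (k + 1) ∧ T k = T' k := by
    intro k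
    induction k with
    | zero =>
      refine ⟨by rw [h.zero_left, h'.zero_left], (hu 0).mul_left_cancel ?_,
        by rw [h.zero_right, h'.zero_right]⟩
      rw [zero_add, pow_one, h.one_left, h'.one_left]
    | succ k ih =>
      obtain ⟨h0, h1, h2⟩ := ih
      have h3 : T (k + 1) = T' (k + 1) := (hc k).mul_left_cancel <| by
        rw [h.right, h'.right, h0, h1, h2]
      exact ⟨h1, (hu (k + 1)).mul_left_cancel (by rw [h.left, h'.left, h0, h1, h3]), h3⟩
  exact funext fun k => (key k).1

/-- Solutions of the recurrences from solutions of first-order functional equations. -/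
theorem largestPartRecurrence_coeff {q a c d : R} {e k t : ℕ → R}
    (e0 : e 0 = 1) (k0 : k 0 = 1)
    (he : ∀ m, e (m + 1) = (q ^ 2) ^ (m + 1) * e (m + 1) + (q ^ 2) ^ m * e m)
    (ht : ∀ n, (1 - c * (q ^ 2) ^ (2 * n + 1)) * t n = (1 + a * q * (q ^ 2) ^ (2 * n)) * k n)
    (hk : ∀ n, (1 - (q ^ 2) ^ (2 * n + 2)) * k (n + 1) =
      (1 + d * q * (q ^ 2) ^ (2 * n + 1)) * t n) :
    LargestPartRecurrence q a c d
        (fun N => PowerSeries.coeff N (PowerSeries.mk e * evenSeries k))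
        (fun N => PowerSeries.coeff N (PowerSeries.X * PowerSeries.mk e * evenSeries t)) := by
  set ρ := PowerSeries.rescale (q ^ 2) with hρ
  set E := PowerSeries.mk e with hE
  set K := evenSeries k with hK
  set S := evenSeries t with hS
  let X : PowerSeries R := PowerSeries.X
  let C : R → PowerSeries R := PowerSeries.C
  have hρX : ρ X = C q ^ 2 * X := by
    rw [hρ, PowerSeries.rescale_X, map_pow]
  -- With `ρ` the substitution `X ↦ q ^ 2 X`, the recursions for `e`, `t` and `k` become the
  -- functional equations `i1`, `i2` and `i3`.
  have i1 : E = (1 + X) * ρ E := by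
    ext m
    rw [add_mul, one_mul, map_add]
    cases m with
    | zero => simp [X, hE, hρ]
    | succ m =>
      rw [PowerSeries.coeff_succ_X_mul]
      simpa [hE, hρ, PowerSeries.coeff_rescale] using he m
  have i2 : S - C c * C q ^ 2 * ρ S = K + C a * C q * ρ K := by
    have : C c * C q ^ 2 * ρ S = C (c * q ^ 2) * ρ S := by simp [C]
    rw [this, ← map_mul]
    ext m
    simp only [C, map_sub, map_add, PowerSeries.coeff_C_mul, hρ, PowerSeries.coeff_rescale, hS, hK,
      evenSeries, PowerSeries.coeff_mk]
    rcases Nat.even_or_odd' m with ⟨n, rfl | rfl⟩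
    · have := ht n
      simp only [even_two, Even.mul_right, if_true, Nat.mul_div_cancel_left n two_pos]
      linear_combination this
    · simp
  have i3 : K - ρ K = X ^ 2 * (S + C d * C q ^ 3 * ρ S) := by
    have : C d * C q ^ 3 * ρ S = C (d * q ^ 3) * ρ S := by simp [C]
    rw [this]
    ext m
    rw [PowerSeries.coeff_X_pow_mul']
    simp only [C, map_sub, map_add, PowerSeries.coeff_C_mul, hρ, PowerSeries.coeff_rescale, hS, hK,
      evenSeries, PowerSeries.coeff_mk]
    rcases m with - | - | m
    · simp
    · simp
    · rw [if_pos (show 2 ≤ m + 1 + 1 by omega), show m + 1 + 1 - 2 = m by omega]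
      rcases Nat.even_or_odd' m with ⟨n, rfl | rfl⟩
      · have := hk n
        have h2 : (2 * n + 1 + 1) / 2 = n + 1 := by omega
        simp only [even_two, Even.mul_right, if_true, Nat.mul_div_cancel_left n two_pos, h2,
          Nat.even_add_one, not_not]
        linear_combination this
      · simp [Nat.even_add_one]
  -- The recurrences to be proved are the coefficients of `hI` and `hII`, and both are combinations
  -- of the three functional equations.
  have hI : (1 - X) * (E * K) =
      (1 + C a * C q * X ^ 2) * ρ (E * K) + (C c + C d * C q) * X * ρ (X * E * S) := by
    rw [map_mul, map_mul, map_mul, hρX]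
    linear_combination (1 - X) * K * i1 + ρ E * i3 + ρ E * X ^ 2 * i2
  have hII : X * E * S - C c * ρ (X * E * S) = C a * C q * X * ρ (E * K) + E * K - ρ (E * K) -
      C d * C q * X * ρ (X * E * S) := by
    rw [map_mul, map_mul, map_mul, hρX]
    linear_combination (X * S - K) * i1 + ρ E * X * i2 - ρ E * i3
  set Γ := E * K with hΓ
  set Τ := X * E * S with hΤ
  have hI' : Γ - X * Γ = ρ Γ + C (a * q) * (X * (X * ρ Γ)) + C c * (X * ρ Τ) +
      C (d * q) * (X * ρ Τ) := by
    simp only [C, map_mul] at hI ⊢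
    linear_combination hI
  have hII' : Τ - C c * ρ Τ = C (a * q) * (X * ρ Γ) + Γ - ρ Γ - C (d * q) * (X * ρ Τ) := by
    simp only [C, map_mul] at hII ⊢
    linear_combination hII
  have hΓ0 : PowerSeries.coeff 0 Γ = 1 := by
    simp [hΓ, hE, hK, evenSeries, e0, k0]
  have hT0 : PowerSeries.coeff 0 Τ = 0 := by simp [hΤ, X, mul_assoc]
  refine ⟨hΓ0, ?_, hT0, fun k => ?_, fun k => ?_⟩
  · have := congrArg (PowerSeries.coeff (0 + 1)) hI'
    simp only [map_sub, map_add, C, PowerSeries.coeff_C_mul, X,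
      PowerSeries.coeff_succ_X_mul, PowerSeries.coeff_zero_X_mul, hρ, PowerSeries.coeff_rescale,
      hΓ0, hT0] at this
    linear_combination this
  · have := congrArg (PowerSeries.coeff (k + 2)) hI'
    simp only [map_sub, map_add, C, PowerSeries.coeff_C_mul, X,
      PowerSeries.coeff_succ_X_mul, hρ, PowerSeries.coeff_rescale] at this ⊢
    linear_combination this
  · have := congrArg (PowerSeries.coeff (k + 1)) hII'
    simp only [map_sub, map_add, C, PowerSeries.coeff_C_mul, X,
      PowerSeries.coeff_succ_X_mul, hρ, PowerSeries.coeff_rescale] at this ⊢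
    linear_combination this

end Recurrence

/-! ### Passing to the limit in the recurrences -/

section Limit

variable {σ : Type}

theorem qPochhammer_mul_qPochhammer_neg (x : MvPowerSeries σ ℤ) {t : MvPowerSeries σ ℤ}
    (ht : MvPowerSeries.constantCoeff t = 0) :
    qPochhammer x t * qPochhammer (-x) t = qPochhammer (x ^ 2) (t ^ 2) := by
  rw [qPochhammer, qPochhammer, ← Multipliable.tprod_mul
    (qPochhammerConverges_of_constantCoeff _ ht) (qPochhammerConverges_of_constantCoeff _ ht)]
  exact tprod_congr fun j => by ring

theorem qPochhammer_sq_mul_qPochhammer_sq (x : MvPowerSeries σ ℤ) {t : MvPowerSeries σ ℤ}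
    (ht : MvPowerSeries.constantCoeff t = 0) :
    qPochhammer x (t ^ 2) * qPochhammer (x * t) (t ^ 2) = qPochhammer x t := by
  have ht2 : MvPowerSeries.constantCoeff (t ^ 2) = 0 := by simp [ht]
  have h0 : ∀ j, 1 - x * (t ^ 2) ^ j = 1 - x * t ^ (2 * j) := fun j => by ring
  have h1 : ∀ j, 1 - x * t * (t ^ 2) ^ j = 1 - x * t ^ (2 * j + 1) := fun j => by ring
  have c0 := qPochhammerConverges_of_constantCoeff x ht2
  have c1 := qPochhammerConverges_of_constantCoeff (x * t) ht2
  simp only [QPochhammerConverges, h0, h1] at c0 c1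
  simp only [qPochhammer, h0, h1]
  exact tprod_even_mul_odd (f := fun j => 1 - x * t ^ j) c0 c1

theorem LargestPartRecurrence.limit {q a c d A : MvPowerSeries σ ℤ} {γ T : ℕ → MvPowerSeries σ ℤ}
    (hq : MvPowerSeries.constantCoeff q = 0) (h : LargestPartRecurrence q a c d γ T)
    (hA : Tendsto γ atTop (𝓝 A)) :
    A * (qPochhammer (q ^ 2) (q ^ 2) * qPochhammer (c * q ^ 2) (q ^ 4)) =
      qPochhammer (-(a * q)) (q ^ 4) * qPochhammer (-(d * q ^ 3)) (q ^ 4) := by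
  have hQ : MvPowerSeries.constantCoeff (q ^ 2) = 0 := by simp [hq]
  have hP : MvPowerSeries.constantCoeff (q ^ 4) = 0 := by simp [hq]
  have hu : ∀ k, IsUnit (1 - (q ^ 2) ^ (k + 1)) := fun k => isUnit_one_sub (by simp [hq])
  have hc : ∀ k, IsUnit (1 - c * (q ^ 2) ^ (k + 1)) := fun k => isUnit_one_sub (by simp [hq])
  -- In closed form, with `Q = q ^ 2`, `e m = Q^(m(m-1)/2) / (Q; Q)_m`, and `k n` below is `(-aq;
  -- q^4)_n (-dq^3; q^4)_n / ((cq^2; q^4)_n (q^4; q^4)_n)`.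
  let e : ℕ → MvPowerSeries σ ℤ := fun m =>
    Nat.rec 1 (fun m em => Ring.inverse (1 - (q ^ 2) ^ (m + 1)) * ((q ^ 2) ^ m * em)) m
  let t' : ℕ → MvPowerSeries σ ℤ → MvPowerSeries σ ℤ := fun n kn =>
    Ring.inverse (1 - c * (q ^ 2) ^ (2 * n + 1)) * ((1 + a * q * (q ^ 2) ^ (2 * n)) * kn)
  let k : ℕ → MvPowerSeries σ ℤ := fun n =>
    Nat.rec 1 (fun n kn => Ring.inverse (1 - (q ^ 2) ^ (2 * n + 1 + 1)) *
      ((1 + d * q * (q ^ 2) ^ (2 * n + 1)) * t' n kn)) n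
  have he : ∀ m, e (m + 1) = (q ^ 2) ^ (m + 1) * e (m + 1) + (q ^ 2) ^ m * e m := fun m => by
    have : (1 - (q ^ 2) ^ (m + 1)) * e (m + 1) = (q ^ 2) ^ m * e m :=
      Ring.mul_inverse_cancel_left _ _ (hu m)
    linear_combination this
  have ht : ∀ n, (1 - c * (q ^ 2) ^ (2 * n + 1)) * t' n (k n) =
      (1 + a * q * (q ^ 2) ^ (2 * n)) * k n := fun n =>
    Ring.mul_inverse_cancel_left _ _ (hc (2 * n))
  have hk : ∀ n, (1 - (q ^ 2) ^ (2 * n + 2)) * k (n + 1) =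
      (1 + d * q * (q ^ 2) ^ (2 * n + 1)) * t' n (k n) := fun n =>
    Ring.mul_inverse_cancel_left _ _ (hu (2 * n + 1))
  have hrec := largestPartRecurrence_coeff (e := e) (k := k) (t := fun n => t' n (k n))
    rfl rfl he ht hk
  have hγ := h.unique hrec hu hc
  set D := qPochhammer (c * q ^ 2) (q ^ 4) * qPochhammer (q ^ 4) (q ^ 4) with hD
  have hDu : IsUnit D :=
    (isUnit_qPochhammer (by simp [hq]) hP).mul (isUnit_qPochhammer hP hP)
  set N := qPochhammer (-(a * q)) (q ^ 4) * qPochhammer (-(d * q ^ 3)) (q ^ 4) with hN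
  have hklim : Tendsto k atTop (𝓝 (Ring.inverse D * N)) := by
    refine tendsto_of_isUnit_mul
      (u := fun n => (∏ j ∈ range n, (1 - c * q ^ 2 * (q ^ 4) ^ j)) *
        ∏ j ∈ range n, (1 - q ^ 4 * (q ^ 4) ^ j)) (u' := D) (fun n => ?_)
      ((tendsto_prod_qPochhammer _ hP).mul (tendsto_prod_qPochhammer _ hP)) ?_
    · refine IsUnit.mul ?_ ?_ <;> refine (IsUnit.prod_iff).2 fun j _ => isUnit_one_sub ?_ <;>
        simp [hq]
    · rw [Ring.mul_inverse_cancel_left _ _ hDu]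
      refine ((tendsto_prod_qPochhammer (-(a * q)) hP).mul
        (tendsto_prod_qPochhammer (-(d * q ^ 3)) hP)).congr fun n => ?_
      induction n with
      | zero => simp [k]
      | succ n ih =>
        simp only [Finset.prod_range_succ]
        have h1 := ht n
        have h2 := hk n
        linear_combination (1 + a * q * q ^ (4 * n)) * (1 + d * q ^ 3 * q ^ (4 * n)) * ih -
          (∏ j ∈ range n, (1 - c * q ^ 2 * (q ^ 4) ^ j)) *
          (∏ j ∈ range n, (1 - q ^ 4 * (q ^ 4) ^ j)) * ((1 - c * q ^ 2 * (q ^ 4) ^ n) * h2 +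
            (1 + d * q ^ 3 * q ^ (4 * n)) * h1)
  have hs := (summable_mul_pow e hQ).hasSum
  rw [tsum_mul_pow_eq_qPochhammer hQ rfl he] at hs
  have hlim := tendsto_sum_antidiagonal hs
    (hklim.comp (Nat.tendsto_div_const_atTop (n := 2) two_ne_zero))
  -- The coefficients of `evenSeries k` vanish at odd indices and so need not converge. Moving the
  -- factor `1 + X` of `E(X) = E(QX) (1 + X)` over to `K` fills the gaps: `(1 + X) K` has
  -- coefficients `k ⌊j/2⌋`, which converge, and the remaining coefficients `e m * Q ^ m` are
  -- summable.
  have hγ' : ∀ n, γ n = ∑ x ∈ antidiagonal n, e x.1 * (q ^ 2) ^ x.1 * (k ∘ (· / 2)) x.2 := by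
    intro n
    have hE : PowerSeries.mk e = PowerSeries.mk (fun m => e m * (q ^ 2) ^ m) *
        (1 + PowerSeries.X) := by
      refine PowerSeries.ext fun m => ?_
      cases m with
      | zero => simp
      | succ m =>
        rw [mul_add, mul_one, map_add, PowerSeries.coeff_succ_mul_X]
        simp only [PowerSeries.coeff_mk]
        conv_lhs => rw [he m]
        ring
    have hK : (1 + PowerSeries.X) * evenSeries k = PowerSeries.mk (k ∘ (· / 2)) := by
      refine PowerSeries.ext fun m => ?_
      rw [add_mul, one_mul, map_add]
      cases m with
      | zero => simp [evenSeries]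
      | succ m =>
        rw [PowerSeries.coeff_succ_X_mul]
        simp only [evenSeries, PowerSeries.coeff_mk, Nat.even_add_one, Function.comp]
        by_cases hm : Even m
        · have : (m + 1) / 2 = m / 2 := by obtain ⟨r, rfl⟩ := hm; omega
          simp [hm, this]
        · simp [hm]
    rw [hγ]
    simp only
    rw [hE, mul_assoc, hK, PowerSeries.coeff_mul]
    simp only [PowerSeries.coeff_mk]
  have hAeq := tendsto_nhds_unique (hA.congr hγ') hlim
  have hfac := qPochhammer_mul_qPochhammer_neg (q ^ 2) hQ
  have h4 : (q ^ 2) ^ 2 = q ^ 4 := by ring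
  rw [h4] at hfac
  calc A * (qPochhammer (q ^ 2) (q ^ 2) * qPochhammer (c * q ^ 2) (q ^ 4))
      = qPochhammer (c * q ^ 2) (q ^ 4) *
          (qPochhammer (q ^ 2) (q ^ 2) * qPochhammer (-q ^ 2) (q ^ 2)) *
          (Ring.inverse D * N) := by rw [hAeq]; ring
    _ = N := by rw [hfac, ← hD, Ring.mul_inverse_cancel_left _ _ hDu]

end Limit

end PrimcRefined

namespace PrimcRefined

open Filter Topology

/-! ### Generating functions of weighted sets -/

section WeightedSets

variable {σ L L' : Type}

/-- The generating function of the elements of `S` by weight. -/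
noncomputable def setGF (wt : L → σ →₀ ℕ) (S : Set L) : MvPowerSeries σ ℤ :=
  fun e => ({x ∈ S | wt x = e}.ncard : ℤ)

/-- Only finitely many elements of `S` have a given weight. -/
def FiniteFibres (wt : L → σ →₀ ℕ) (S : Set L) : Prop :=
  ∀ e, {x ∈ S | wt x = e}.Finite

theorem coeff_setGF (wt : L → σ →₀ ℕ) (S : Set L) (e : σ →₀ ℕ) :
    MvPowerSeries.coeff e (setGF wt S) = {x ∈ S | wt x = e}.ncard := rfl

theorem FiniteFibres.mono {wt : L → σ →₀ ℕ} {S T : Set L} (h : FiniteFibres wt T) (hST : S ⊆ T) :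
    FiniteFibres wt S :=
  fun e => (h e).subset fun _ hx => ⟨hST hx.1, hx.2⟩

theorem setGF_empty (wt : L → σ →₀ ℕ) : setGF wt ∅ = 0 := by
  ext e
  simp [coeff_setGF]

theorem setGF_singleton {wt : L → σ →₀ ℕ} {x : L} (hx : wt x = 0) : setGF wt {x} = 1 := by
  classical
  ext e
  rw [coeff_setGF, MvPowerSeries.coeff_one]
  split_ifs with h
  · have : {y ∈ ({x} : Set L) | wt y = e} = {x} := by
      ext y
      simp only [Set.mem_singleton_iff, Set.mem_ofPred_eq, and_iff_left_iff_imp]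
      rintro rfl
      rw [hx, h]
    rw [this, Set.ncard_singleton, Nat.cast_one]
  · have : {y ∈ ({x} : Set L) | wt y = e} = ∅ := by
      ext y
      simp only [Set.mem_singleton_iff, Set.mem_ofPred_eq, Set.mem_empty_iff_false, iff_false]
      rintro ⟨rfl, he⟩
      exact h (he.symm.trans hx)
    rw [this, Set.ncard_empty, Nat.cast_zero]

theorem setGF_union {wt : L → σ →₀ ℕ} {S T : Set L} (h : Disjoint S T) (hS : FiniteFibres wt S)
    (hT : FiniteFibres wt T) : setGF wt (S ∪ T) = setGF wt S + setGF wt T := by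
  ext e
  rw [map_add, coeff_setGF, coeff_setGF, coeff_setGF, ← Nat.cast_add, ← Set.ncard_union_eq
    (h.mono (Set.sep_subset _ _) (Set.sep_subset _ _)) (hS e) (hT e)]
  congr 2
  ext x
  simp only [Set.mem_union, Set.mem_ofPred_eq]
  tauto

/-- An injection that shifts the weight by `s` matches the fibre over `e` with the fibre over `e -
s`, so the cardinalities agree even without finiteness. -/
theorem setGF_image {wt : L → σ →₀ ℕ} {wt' : L' → σ →₀ ℕ} {S : Set L} {f : L → L'} (s : σ →₀ ℕ)
    (hf : S.InjOn f) (hs : ∀ x ∈ S, wt' (f x) = s + wt x) :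
    setGF wt' (f '' S) = MvPowerSeries.monomial s 1 * setGF wt S := by
  ext e
  rw [MvPowerSeries.coeff_monomial_mul]
  split_ifs with h
  · rw [one_mul, coeff_setGF, coeff_setGF, 
      ← (hf.mono (Set.sep_subset _ _)).ncard_image]
    congr 2
    ext y
    constructor
    · rintro ⟨⟨x, hx, rfl⟩, hy⟩
      refine ⟨x, ⟨hx, ?_⟩, rfl⟩
      rw [← hy, hs x hx, add_tsub_cancel_left]
    · rintro ⟨x, ⟨hx, he⟩, rfl⟩
      refine ⟨⟨x, hx, rfl⟩, ?_⟩
      rw [hs x hx, he, add_tsub_cancel_of_le h]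
  · rw [coeff_setGF]
    have : {y ∈ f '' S | wt' y = e} = ∅ := by
      ext y
      simp only [Set.mem_ofPred_eq, Set.mem_empty_iff_false, iff_false]
      rintro ⟨⟨x, hx, rfl⟩, hy⟩
      exact h (hy ▸ hs x hx ▸ le_self_add)
    rw [this, Set.ncard_empty, Nat.cast_zero]

theorem tendsto_setGF {wt : L → σ →₀ ℕ} {S : ℕ → Set L} {T : Set L}
    (h : ∀ e, ∀ᶠ n in atTop, ∀ x, wt x = e → (x ∈ S n ↔ x ∈ T)) :
    Tendsto (fun n => setGF wt (S n)) atTop (𝓝 (setGF wt T)) := by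
  rw [MvPowerSeries.WithPiTopology.tendsto_iff_coeff_tendsto]
  intro e
  refine tendsto_nhds_of_eventually_eq ?_
  filter_upwards [h e] with n hn
  rw [coeff_setGF, coeff_setGF]
  congr 2
  ext x
  exact and_congr_left fun hx => hn x hx

end WeightedSets

/-! ### Primc's partitions by their first part -/

section PrimcLists

/-- The relation between neighbours in Primc's partitions. -/
def PrimcRel (x y : ℕ × Fin 4) : Prop :=
  (y.1 < x.1 ∨ (y.1 = x.1 ∧ y.2 ≤ x.2)) ∧ y.1 + primcMatrix x.2 y.2 ≤ x.1

/-- Primc's partitions, as lists. -/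
def primcLists : Set (List (ℕ × Fin 4)) :=
  {l | (∀ x ∈ l, 0 < x.1) ∧ l.IsChain PrimcRel}

theorem nil_mem_primcLists : [] ∈ primcLists := by simp [primcLists]

theorem cons_mem_primcLists {x : ℕ × Fin 4} {l : List (ℕ × Fin 4)} :
    x :: l ∈ primcLists ↔ 0 < x.1 ∧ (∀ y ∈ l.head?, PrimcRel x y) ∧ l ∈ primcLists := by
  simp only [primcLists, Set.mem_ofPred_eq, List.mem_cons, forall_eq_or_imp, List.isChain_cons]
  tauto

/-- The first clause of `PrimcRel` is a transitive, antisymmetric order, and a list sorted for such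
an order is determined by its multiset. -/
theorem primcLists_injOn_coe :
    primcLists.InjOn (Multiset.ofList : List (ℕ × Fin 4) → Multiset (ℕ × Fin 4)) := by
  let r : ℕ × Fin 4 → ℕ × Fin 4 → Prop := fun x y => y.1 < x.1 ∨ (y.1 = x.1 ∧ y.2 ≤ x.2)
  have : Trans r r r := ⟨fun {x y z} hxy hyz => by
    rcases hxy with h | ⟨h, h'⟩ <;> rcases hyz with g | ⟨g, g'⟩
    · exact Or.inl (g.trans h)
    · exact Or.inl (g ▸ h)
    · exact Or.inl (h ▸ g)
    · exact Or.inr ⟨g.trans h, g'.trans h'⟩⟩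
  have hsorted : ∀ l ∈ primcLists, l.Pairwise r := fun l hl =>
    (hl.2.imp fun _ _ h => h.1).pairwise
  intro l hl l' hl' h
  refine (Multiset.coe_eq_coe.1 h).eq_of_pairwise (le := r) ?_ (hsorted l hl) (hsorted l' hl')
  rintro x y - - (h | ⟨h, h'⟩) (g | ⟨g, g'⟩)
  · omega
  · omega
  · omega
  · exact Prod.ext g (le_antisymm g' h')

variable {σ : Type} (ε : Var → σ →₀ ℕ)

/-- The exponent of a part of Primc's partitions, after dilation. -/
noncomputable def primcPartWeight (x : ℕ × Fin 4) : σ →₀ ℕ :=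
  primcDilation x • ε Var.q + ![ε Var.a, 0, ε Var.c, ε Var.d] x.2

/-- The exponent of a list of parts. -/
noncomputable def primcWeight (l : List (ℕ × Fin 4)) : σ →₀ ℕ :=
  (l.map (primcPartWeight ε)).sum

variable {ε}

/-- As dilation does not decrease sizes, a bound on the weight bounds the size when `ε q ≠ 0`. This
gives finiteness of the fibres and the limit in `tendsto_leftGF`. -/
theorem size_smul_le_primcWeight (l : List (ℕ × Fin 4)) :
    size (l : Multiset (ℕ × Fin 4)) • ε Var.q ≤ primcWeight ε l := by
  induction l with
  | nil => simp [size, primcWeight]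
  | cons x l ih =>
    have h : x.1 ≤ primcDilation x := by
      obtain ⟨k, i⟩ := x
      fin_cases i <;> simp [primcDilation] <;> omega
    have h' : x.1 • ε Var.q ≤ primcPartWeight ε x :=
      (nsmul_le_nsmul_left zero_le h).trans le_self_add
    simp only [size, primcWeight, Multiset.map_coe, Multiset.sum_coe, List.map_cons,
      List.sum_cons, add_smul] at ih ⊢
    exact add_le_add h' ih

theorem exists_bound_of_smul_le {s : σ →₀ ℕ} (hs : s ≠ 0) (e : σ →₀ ℕ) :
    ∃ N, ∀ n : ℕ, n • s ≤ e → n ≤ N := by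
  obtain ⟨v, hv⟩ := Finsupp.ne_iff.1 hs
  refine ⟨e v, fun n hn => ?_⟩
  have h1 := hn v
  rw [Finsupp.smul_apply, smul_eq_mul] at h1
  exact (Nat.le_mul_of_pos_right n (Nat.pos_of_ne_zero hv)).trans h1

theorem finite_size_le {C : Type} [Finite C] (N : ℕ) :
    {p : Multiset (ℕ × C) | IsColouredPartition p ∧ size p ≤ N}.Finite := by
  refine ((Set.finite_Iic N).biUnion fun n _ => finite_colouredPartitions (C := C) n).subset ?_
  intro p hp
  simp only [Set.mem_iUnion]
  exact ⟨size p, hp.2, hp.1, rfl⟩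

theorem finiteFibres_primcLists (hq : ε Var.q ≠ 0) :
    FiniteFibres (primcWeight ε) primcLists := by
  intro e
  obtain ⟨N, hN⟩ := exists_bound_of_smul_le hq e
  refine Set.Finite.of_finite_image ((finite_size_le (C := Fin 4) N).subset ?_)
    (primcLists_injOn_coe.mono (Set.sep_subset _ _))
  rintro _ ⟨l, ⟨hl, rfl⟩, rfl⟩
  exact ⟨hl.1, hN _ (size_smul_le_primcWeight l)⟩

/-- The generating function of the lists in Primc's identity whose first part satisfies `P`. -/
noncomputable def headGF (ε : Var → σ →₀ ℕ) (P : Option (ℕ × Fin 4) → Prop) :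
    MvPowerSeries σ ℤ :=
  setGF (primcWeight ε) {l ∈ primcLists | P l.head?}

theorem headGF_or (hq : ε Var.q ≠ 0) {P P' : Option (ℕ × Fin 4) → Prop} (h : ∀ o, P o → ¬P' o) :
    headGF ε (fun o => P o ∨ P' o) = headGF ε P + headGF ε P' := by
  rw [headGF, headGF, headGF, ← setGF_union]
  · congr 1
    ext l
    simp only [Set.mem_ofPred_eq, Set.mem_union]
    tauto
  · rw [Set.disjoint_left]
    exact fun l hl hl' => h _ hl.2 hl'.2
  all_goals exact (finiteFibres_primcLists hq).mono (Set.sep_subset _ _)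

theorem headGF_congr {P P' : Option (ℕ × Fin 4) → Prop} (h0 : P none ↔ P' none)
    (h : ∀ k x, P (some (k + 1, x)) ↔ P' (some (k + 1, x))) : headGF ε P = headGF ε P' := by
  rw [headGF, headGF]
  congr 1
  ext l
  refine and_congr_right fun hl => ?_
  rcases l with - | ⟨⟨k, x⟩, l⟩
  · exact h0
  · obtain ⟨k, rfl⟩ := Nat.exists_eq_succ_of_ne_zero (cons_mem_primcLists.1 hl).1.ne'
    exact h k x

theorem headGF_none : headGF ε (fun o => o = none) = 1 := by
  rw [headGF, ← setGF_singleton (wt := primcWeight ε) (x := []) rfl]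
  congr 1
  ext l
  rcases l with - | ⟨x, l⟩ <;> simp [nil_mem_primcLists]

theorem headGF_some_zero (x : Fin 4) : headGF ε (fun o => o = some (0, x)) = 0 := by
  rw [headGF, ← setGF_empty (primcWeight ε)]
  congr 1
  ext l
  rcases l with - | ⟨y, l⟩
  · simp
  · simp only [List.head?_cons, Option.some.injEq, Set.mem_ofPred_eq, Set.mem_empty_iff_false,
      iff_false, not_and, cons_mem_primcLists]
    rintro ⟨h, -⟩ rfl
    exact lt_irrefl _ h

theorem headGF_some {x : ℕ × Fin 4} (hx : 0 < x.1) :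
    headGF ε (fun o => o = some x) = MvPowerSeries.monomial (primcPartWeight ε x) 1 *
      headGF ε (fun o => ∀ y ∈ o, PrimcRel x y) := by
  rw [headGF, headGF, ← setGF_image (f := List.cons x) (primcPartWeight ε x)
    (List.cons_injective.injOn) (wt' := primcWeight ε) (fun l _ => by simp [primcWeight])]
  congr 1
  ext l
  rcases l with - | ⟨y, l⟩
  · simp
  · simp only [List.head?_cons, Option.some.injEq, Set.mem_ofPred_eq, cons_mem_primcLists,
      Set.mem_image, List.cons.injEq]
    constructor
    · rintro ⟨⟨h1, h2, h3⟩, rfl⟩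
      exact ⟨l, ⟨h3, h2⟩, rfl, rfl⟩
    · rintro ⟨l', ⟨h3, h2⟩, rfl, rfl⟩
      exact ⟨⟨hx, h2, h3⟩, rfl⟩

/-- The variables of `ε`, as monomials. -/
noncomputable def expVar (ε : Var → σ →₀ ℕ) (v : Var) : MvPowerSeries σ ℤ :=
  MvPowerSeries.monomial (ε v) 1

theorem monomial_smul_add (n : ℕ) (s t : σ →₀ ℕ) :
    MvPowerSeries.monomial (n • s + t) (1 : ℤ) =
      MvPowerSeries.monomial s 1 ^ n * MvPowerSeries.monomial t 1 := by
  rw [MvPowerSeries.monomial_pow, MvPowerSeries.monomial_mul_monomial, one_pow, one_mul]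

theorem constantCoeff_expVar {v : Var} (hv : ε v ≠ 0) :
    MvPowerSeries.constantCoeff (expVar ε v) = 0 := by
  classical
  rw [expVar, ← MvPowerSeries.coeff_zero_eq_constantCoeff_apply, MvPowerSeries.coeff_monomial,
    if_neg hv.symm]

/-- The generating function of the lists with all parts of size at most `k`. -/
noncomputable def boundedGF (ε : Var → σ →₀ ℕ) (k : ℕ) : MvPowerSeries σ ℤ :=
  headGF ε (fun o => ∀ y ∈ o, y.1 ≤ k)

/-- The generating function of the lists with all parts of size less than `k` or equal
to `k_b`. -/
noncomputable def leftGF (ε : Var → σ →₀ ℕ) : ℕ → MvPowerSeries σ ℤ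
  -- Only the empty list may follow `1_a`.
  | 0 => 1
  | k + 1 => headGF ε (fun o => (∀ y ∈ o, y.1 ≤ k) ∨ o = some (k + 1, 1))

/-- The generating function of the lists that `k_c` may precede. -/
noncomputable def rightGF (ε : Var → σ →₀ ℕ) : ℕ → MvPowerSeries σ ℤ
  -- There is no part `0_d`, and this value makes its contribution vanish in the formula for
  -- `headGF_d`.
  | 0 => 0
  | k + 1 => headGF ε (fun o => ∀ y ∈ o, PrimcRel (k + 1, 2) y)

theorem leftGF_succ (hq : ε Var.q ≠ 0) (k : ℕ) :
    leftGF ε (k + 1) = boundedGF ε k + headGF ε (fun o => o = some (k + 1, 1)) := by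
  rw [leftGF, headGF_or hq, boundedGF]
  rintro o h rfl
  simp at h

theorem boundedGF_zero : boundedGF ε 0 = 1 := by
  rw [boundedGF, ← headGF_none (ε := ε)]
  exact headGF_congr (by simp) (by simp)

/-- By row `a` of the matrix, `(k+1)_a` may be followed by `k_b` or by anything of size below `k`.
-/
theorem headGF_a (k : ℕ) : headGF ε (fun o => o = some (k + 1, 0)) =
    expVar ε .a * expVar ε .q * (expVar ε .q ^ 2) ^ k * leftGF ε k := by
  rw [headGF_some k.succ_pos, primcPartWeight, monomial_smul_add]
  have h : headGF ε (fun o => ∀ y ∈ o, PrimcRel (k + 1, 0) y) = leftGF ε k := by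
    cases k with
    | zero =>
      rw [leftGF, ← headGF_none (ε := ε)]
      refine headGF_congr (by simp) fun k x => ?_
      fin_cases x <;> simp [PrimcRel, primcMatrix]
    | succ n =>
      rw [leftGF]
      refine headGF_congr (by simp) fun k x => ?_
      fin_cases x <;> simp [PrimcRel, primcMatrix] <;> omega
  rw [h]
  simp only [primcDilation, expVar, Matrix.cons_val_zero, Nat.mul_add_one, Nat.add_one_sub_one]
  ring

/-- By row `b`, `(k+1)_b` may be followed by itself or by anything smaller in size, so the same
`leftGF (k + 1)` reappears on the right; this is the origin of the factor `1 - Q^(k+1)` in the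
recurrences. -/
theorem headGF_b (k : ℕ) : headGF ε (fun o => o = some (k + 1, 1)) =
    (expVar ε .q ^ 2) ^ (k + 1) * leftGF ε (k + 1) := by
  rw [headGF_some k.succ_pos, primcPartWeight, monomial_smul_add]
  have h : headGF ε (fun o => ∀ y ∈ o, PrimcRel (k + 1, 1) y) = leftGF ε (k + 1) := by
    rw [leftGF]
    refine headGF_congr (by simp) fun k x => ?_
    fin_cases x <;> simp [PrimcRel, primcMatrix] <;> omega
  rw [h]
  simp [primcDilation, expVar, MvPowerSeries.monomial_zero_one, pow_mul]

theorem headGF_c (k : ℕ) : headGF ε (fun o => o = some (k + 1, 2)) =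
    expVar ε .c * (expVar ε .q ^ 2) ^ (k + 1) * rightGF ε (k + 1) := by
  rw [headGF_some k.succ_pos, primcPartWeight, monomial_smul_add]
  simp only [primcDilation, expVar, Matrix.cons_val, rightGF]
  ring

/-- Rows `c` and `d` of the matrix coincide, and the order of the colours excludes no further
continuation, so `k_d` and `k_c` have the same followers. -/
theorem headGF_d (k : ℕ) : headGF ε (fun o => o = some (k, 3)) =
    expVar ε .d * expVar ε .q * (expVar ε .q ^ 2) ^ k * rightGF ε k := by
  cases k with
  | zero => rw [headGF_some_zero, rightGF, mul_zero]
  | succ k =>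
    rw [headGF_some k.succ_pos, primcPartWeight, monomial_smul_add]
    have h : headGF ε (fun o => ∀ y ∈ o, PrimcRel (k + 1, 3) y) = rightGF ε (k + 1) := by
      rw [rightGF]
      refine headGF_congr (by simp) fun k x => ?_
      fin_cases x <;> simp [PrimcRel, primcMatrix]
      omega
    rw [h]
    simp only [primcDilation, expVar, Matrix.cons_val]
    ring

theorem boundedGF_succ (hq : ε Var.q ≠ 0) (k : ℕ) : boundedGF ε (k + 1) =
    leftGF ε (k + 1) + headGF ε (fun o => o = some (k + 1, 0)) +
      headGF ε (fun o => o = some (k + 1, 2)) + headGF ε (fun o => o = some (k + 1, 3)) := by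
  rw [leftGF, ← headGF_or hq, ← headGF_or hq, ← headGF_or hq, boundedGF]
  · refine headGF_congr (by simp) fun k x => ?_
    fin_cases x <;> simp <;> omega
  all_goals
    rintro o h rfl
    simp at h

/-- What may follow `(k+1)_c` is `(k+1)_a`, `(k+1)_c`, or anything of size at most `k` other than
`k_d`. Putting the exception on the left avoids subtraction. -/
theorem rightGF_succ (hq : ε Var.q ≠ 0) (k : ℕ) :
    rightGF ε (k + 1) + headGF ε (fun o => o = some (k, 3)) =
      headGF ε (fun o => o = some (k + 1, 0)) + headGF ε (fun o => o = some (k + 1, 2)) +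
        boundedGF ε k := by
  rw [rightGF, boundedGF, ← headGF_or hq, ← headGF_or hq, ← headGF_or hq]
  · refine headGF_congr (by simp) fun k x => ?_
    fin_cases x <;> simp [PrimcRel, primcMatrix] <;> omega
  · rintro o (rfl | rfl) h <;> simp at h
  · rintro o rfl h
    simp at h
  · rintro o h rfl
    simp [PrimcRel, primcMatrix] at h

theorem largestPartRecurrence_primc (hq : ε Var.q ≠ 0) :
    LargestPartRecurrence (expVar ε .q) (expVar ε .a) (expVar ε .c) (expVar ε .d)
      (leftGF ε) (rightGF ε) := by
  have hG : ∀ k, boundedGF ε k = (1 - (expVar ε .q ^ 2) ^ (k + 1)) * leftGF ε (k + 1) := fun k => by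
    have := leftGF_succ hq k
    rw [headGF_b] at this
    linear_combination -this
  refine ⟨rfl, ?_, rfl, fun k => ?_, fun k => ?_⟩
  · have := hG 0
    rw [boundedGF_zero, zero_add, pow_one] at this
    exact this.symm
  · have := boundedGF_succ hq k
    rw [hG (k + 1), headGF_a, headGF_c, headGF_d] at this
    linear_combination this
  · have := rightGF_succ hq k
    rw [hG k, headGF_a, headGF_c, headGF_d] at this
    linear_combination this

theorem tendsto_leftGF (hq : ε Var.q ≠ 0) :
    Tendsto (leftGF ε) atTop (𝓝 (setGF (primcWeight ε) primcLists)) := by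
  -- The shift reaches the successor clause of `leftGF`, where the bound on the parts is visible.
  rw [← tendsto_add_atTop_iff_nat 1]
  refine tendsto_setGF fun e => ?_
  obtain ⟨N, hN⟩ := exists_bound_of_smul_le hq e
  filter_upwards [eventually_ge_atTop N] with n hn l hl
  refine ⟨And.left, fun h => ⟨h, Or.inl fun y hy => ?_⟩⟩
  refine le_trans (le_trans ?_ (hN _ (hl ▸ size_smul_le_primcWeight l))) hn
  exact Multiset.single_le_sum (fun _ _ => Nat.zero_le _) _
    (Multiset.mem_map_of_mem Prod.fst (Multiset.mem_coe.2 (List.mem_of_mem_head? hy)))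

theorem primcLists_genFun (hq : ε Var.q ≠ 0) :
    setGF (primcWeight ε) primcLists *
        (qPochhammer (expVar ε .q ^ 2) (expVar ε .q ^ 2) *
          qPochhammer (expVar ε .c * expVar ε .q ^ 2) (expVar ε .q ^ 4)) =
      qPochhammer (-(expVar ε .a * expVar ε .q)) (expVar ε .q ^ 4) *
        qPochhammer (-(expVar ε .d * expVar ε .q ^ 3)) (expVar ε .q ^ 4) :=
  (largestPartRecurrence_primc hq).limit (constantCoeff_expVar hq) (tendsto_leftGF hq)

end PrimcLists

end PrimcRefined

namespace PrimcRefined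

/-! ### Dilation to two-coloured partitions -/

section Dilation

/-- The two-coloured part given by the dilation of a part of Primc's partitions. -/
def dilate (x : ℕ × Fin 4) : ℕ × Colour :=
  (primcDilation x, ![Colour.red, Colour.green, Colour.red, Colour.green] x.2)

/-- The inverse of `dilate`. -/
def contract : ℕ × Colour → ℕ × Fin 4
  | (s, Colour.red) => if Odd s then ((s + 1) / 2, 0) else (s / 2, 2)
  | (s, Colour.green) => if Odd s then ((s - 1) / 2, 3) else (s / 2, 1)

theorem contract_dilate {x : ℕ × Fin 4} (hx : 0 < x.1) : contract (dilate x) = x := by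
  obtain ⟨k, i⟩ := x
  obtain ⟨k, rfl⟩ := Nat.exists_eq_succ_of_ne_zero hx.ne'
  fin_cases i <;> simp [dilate, primcDilation, contract, Nat.mul_add_one, Nat.odd_add_one]
  omega

theorem dilate_contract {x : ℕ × Colour} (hx : 0 < x.1) (hx' : x ≠ (1, Colour.green)) :
    dilate (contract x) = x ∧ 0 < (contract x).1 := by
  obtain ⟨s, c⟩ := x
  have hs : 0 < s := hx
  rcases Nat.even_or_odd' s with ⟨n, rfl | rfl⟩
  · have hn : ¬Odd (2 * n) := by simp
    cases c <;> simp [contract, dilate, primcDilation, hn] <;> omega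
  · cases c <;> simp [contract, dilate, primcDilation] at hx' ⊢ <;> omega

/-- For each pair of colours the parity of the dilated difference is fixed, so a gap bound of 0 to 3
rounds to a bound on the undilated difference; the sixteen cases reproduce the matrix together with
the order on coloured parts. -/
theorem minGap_dilate {x y : ℕ × Fin 4} (hx : 0 < x.1) (hy : 0 < y.1) :
    ((dilate y).1 ≤ (dilate x).1 ∧ (dilate y).1 + minGap (dilate x) (dilate y) ≤ (dilate x).1) ↔
      PrimcRel x y := by
  obtain ⟨k, i⟩ := x
  obtain ⟨k, rfl⟩ := Nat.exists_eq_succ_of_ne_zero hx.ne'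
  obtain ⟨n, j⟩ := y
  obtain ⟨n, rfl⟩ := Nat.exists_eq_succ_of_ne_zero hy.ne'
  fin_cases i <;> fin_cases j <;>
    simp [dilate, primcDilation, minGap, PrimcRel, primcMatrix, Nat.mul_add_one, Nat.odd_add_one] <;>
    omega

/-- The two-coloured partitions satisfying the gap condition are the dilations of Primc's
partitions. -/
theorem exists_primcLists_dilate_iff {p : Multiset (ℕ × Colour)} :
    (IsColouredPartition p ∧ (1, Colour.green) ∉ p ∧ GapCondition p) ↔
      ∃ l ∈ primcLists, ((l.map dilate : List (ℕ × Colour)) : Multiset (ℕ × Colour)) = p := by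
  constructor
  · rintro ⟨hpos, hgreen, g, rfl, hg⟩
    have hmem : ∀ x ∈ g, dilate (contract x) = x ∧ 0 < (contract x).1 := fun x hx =>
      dilate_contract (hpos x hx) (by rintro rfl; exact hgreen hx)
    have hmap : (g.map contract).map dilate = g := by
      rw [List.map_map]
      exact (List.map_congr_left fun x hx => (hmem x hx).1).trans (List.map_id g)
    have hpos' : ∀ x ∈ g.map contract, 0 < x.1 := by
      intro x hx
      obtain ⟨y, hy, rfl⟩ := List.mem_map.1 hx
      exact (hmem y hy).2
    refine ⟨g.map contract, ⟨hpos', ?_⟩, by rw [hmap]⟩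
    rw [← hmap, List.isChain_map] at hg
    exact hg.imp_of_mem_imp fun x y hx hy h => (minGap_dilate (hpos' x hx) (hpos' y hy)).1 h
  · rintro ⟨l, ⟨hpos, hl⟩, rfl⟩
    refine ⟨?_, ?_, l.map dilate, rfl, ?_⟩
    · intro x hx
      obtain ⟨⟨k, i⟩, hy, rfl⟩ := List.mem_map.1 (Multiset.mem_coe.1 hx)
      have := hpos _ hy
      fin_cases i <;> simp [dilate, primcDilation] at this ⊢ <;> omega
    · intro hx
      obtain ⟨⟨k, i⟩, hy, h⟩ := List.mem_map.1 (Multiset.mem_coe.1 hx)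
      have := hpos _ hy
      fin_cases i <;> simp [dilate, primcDilation] at this h
      omega
    · rw [List.isChain_map]
      exact hl.imp_of_mem_imp fun x y hx hy h => (minGap_dilate (hpos x hx) (hpos y hy)).2 h

theorem primcLists_injOn_dilate :
    primcLists.InjOn (fun l => ((l.map dilate : List (ℕ × Colour)) : Multiset (ℕ × Colour))) := by
  intro l hl l' hl' h
  have hinv : ∀ l ∈ primcLists, (l.map dilate).map contract = l := fun l hl => by
    rw [List.map_map]
    exact (List.map_congr_left fun x hx => contract_dilate (hl.1 x hx)).trans (List.map_id l)
  refine primcLists_injOn_coe hl hl' ?_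
  have := congrArg (Multiset.map contract) h
  simpa only [Multiset.map_coe, hinv l hl, hinv l' hl'] using this

/-- The statistics on Primc's partitions counted by `A₂`. -/
def primcStats (l : List (ℕ × Fin 4)) : ℕ × ℕ × ℕ :=
  (l.countP (fun x => x.2 = 0), l.countP (fun x => x.2 = 2), l.countP (fun x => x.2 = 3))

theorem A₂_eq_ncard (n k l m : ℕ) : A₂ n k l m =
    {g ∈ {g ∈ primcLists | (g.map primcDilation).sum = n} | primcStats g = (k, l, m)}.ncard := by
  rw [A₂, ← (primcLists_injOn_dilate.mono ((Set.sep_subset _ _).trans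
    (Set.sep_subset _ _))).ncard_image]
  have hcount : ∀ (P : ℕ × Colour → Prop) [DecidablePred P] (i : Fin 4),
      (∀ x : ℕ × Fin 4, 0 < x.1 → (P (dilate x) ↔ x.2 = i)) → ∀ g ∈ primcLists,
        Multiset.countP P ((g.map dilate : List (ℕ × Colour)) : Multiset (ℕ × Colour)) =
          g.countP (fun x => x.2 = i) := by
    intro P _ i hP g hg
    rw [Multiset.coe_countP, List.countP_map]
    refine List.countP_congr fun x hx => ?_
    simpa using hP x (hg.1 x hx)
  have hodd : ∀ k i (c : Colour), (Odd (dilate (k + 1, i)).1 ∧ (dilate (k + 1, i)).2 = c) ↔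
      (c = Colour.red ∧ i = 0 ∨ c = Colour.green ∧ i = 3) := by
    intro k i c
    have hk : 2 * (k + 1) - 1 = 2 * k + 1 := by omega
    fin_cases i <;> cases c <;> simp [dilate, primcDilation, hk, parity_simps]
  have heven : ∀ k i (c : Colour), (Even (dilate (k + 1, i)).1 ∧ (dilate (k + 1, i)).2 = c) ↔
      (c = Colour.red ∧ i = 2 ∨ c = Colour.green ∧ i = 1) := by
    intro k i c
    have hk : 2 * (k + 1) - 1 = 2 * k + 1 := by omega
    fin_cases i <;> cases c <;> simp [dilate, primcDilation, hk, parity_simps]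
  have h1 := hcount (fun x => Odd x.1 ∧ x.2 = Colour.red) 0 (by
    rintro ⟨k, i⟩ hx
    obtain ⟨k, rfl⟩ := Nat.exists_eq_succ_of_ne_zero hx.ne'
    simpa using hodd k i Colour.red)
  have h2 := hcount (fun x => Even x.1 ∧ x.2 = Colour.red) 2 (by
    rintro ⟨k, i⟩ hx
    obtain ⟨k, rfl⟩ := Nat.exists_eq_succ_of_ne_zero hx.ne'
    simpa using heven k i Colour.red)
  have h3 := hcount (fun x => Odd x.1 ∧ x.2 = Colour.green) 3 (by
    rintro ⟨k, i⟩ hx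
    obtain ⟨k, rfl⟩ := Nat.exists_eq_succ_of_ne_zero hx.ne'
    simpa using hodd k i Colour.green)
  have hsize : ∀ g : List (ℕ × Fin 4),
      size ((g.map dilate : List (ℕ × Colour)) : Multiset (ℕ × Colour)) =
        (g.map primcDilation).sum := fun g => by
    simp [size, Function.comp_def, dilate]
  congr 1
  ext p
  simp only [Set.mem_ofPred_eq, Set.mem_image, primcStats, Prod.mk.injEq]
  constructor
  · rintro ⟨hp, hs, hg, hgap, c1, c2, c3⟩
    obtain ⟨g, hl, rfl⟩ := exists_primcLists_dilate_iff.1 ⟨hp, hg, hgap⟩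
    rw [hsize] at hs
    rw [h1 g hl] at c1
    rw [h2 g hl] at c2
    rw [h3 g hl] at c3
    exact ⟨g, ⟨⟨hl, hs⟩, c1, c2, c3⟩, rfl⟩
  · rintro ⟨g, ⟨⟨hl, hs⟩, c1, c2, c3⟩, rfl⟩
    obtain ⟨hp, hg, hgap⟩ := exists_primcLists_dilate_iff.2 ⟨g, hl, rfl⟩
    exact ⟨hp, (hsize g).trans hs, hg, hgap, (h1 g hl).trans c1, (h2 g hl).trans c2,
      (h3 g hl).trans c3⟩

theorem primcCount_eq_ncard (n : ℕ) :
    primcCount n = {g ∈ primcLists | (g.map primcDilation).sum = n}.ncard := by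
  rw [primcCount, ← (primcLists_injOn_coe.mono (Set.sep_subset _ _)).ncard_image]
  congr 1
  ext p
  constructor
  · rintro ⟨hp, ⟨g, rfl, hg⟩, hs⟩
    exact ⟨g, ⟨⟨hp, hg⟩, by simpa using hs⟩, rfl⟩
  · rintro ⟨g, ⟨⟨hp, hg⟩, hs⟩, rfl⟩
    exact ⟨hp, ⟨g, rfl, hg⟩, by simpa using hs⟩

theorem primcWeight_apply {σ : Type} (ε : Var → σ →₀ ℕ) (g : List (ℕ × Fin 4)) (v : σ) :
    primcWeight ε g v = (g.map primcDilation).sum * ε Var.q v +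
      (primcStats g).1 * ε Var.a v + (primcStats g).2.1 * ε Var.c v +
        (primcStats g).2.2 * ε Var.d v := by
  induction g with
  | nil => simp [primcWeight, primcStats]
  | cons x g ih =>
    obtain ⟨k, i⟩ := x
    simp only [primcWeight, primcStats, List.map_cons, List.sum_cons, Finsupp.add_apply,
      List.countP_cons, primcPartWeight, Finsupp.smul_apply, smul_eq_mul] at ih ⊢
    rw [ih]
    fin_cases i <;> simp <;> ring

theorem genFun_A₂ : genFun A₂ =
    setGF (primcWeight fun v => Finsupp.single v 1) primcLists := by
  ext e
  rw [coeff_setGF]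
  change ((A₂ (e Var.q) (e Var.a) (e Var.c) (e Var.d) : ℕ) : ℤ) = _
  rw [A₂_eq_ncard]
  congr 2
  ext g
  have hiff : primcWeight (fun v => Finsupp.single v 1) g = e ↔
      (g.map primcDilation).sum = e Var.q ∧ primcStats g = (e Var.a, e Var.c, e Var.d) := by
    rw [Finsupp.ext_iff]
    constructor
    · intro h
      have hq := h Var.q
      have ha := h Var.a
      have hc := h Var.c
      have hd := h Var.d
      rw [primcWeight_apply] at hq ha hc hd
      simp at hq ha hc hd
      exact ⟨hq, Prod.ext ha (Prod.ext hc hd)⟩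
    · rintro ⟨hq, hs⟩ v
      rw [primcWeight_apply, hq, hs]
      cases v <;> simp
  simp only [Set.mem_ofPred_eq, hiff, and_assoc]

/-- Giving `a`, `c` and `d` exponent zero is the specialisation `a = c = d = 1`. -/
theorem mk_primcCount : PowerSeries.mk (fun n => (primcCount n : ℤ)) =
    setGF (primcWeight fun v => if v = Var.q then Finsupp.single () 1 else 0) primcLists := by
  refine MvPowerSeries.ext fun e => ?_
  obtain ⟨n, rfl⟩ : ∃ n, e = Finsupp.single () n := ⟨e (), Finsupp.ext fun _ => by simp⟩
  rw [coeff_setGF]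
  change PowerSeries.coeff n (PowerSeries.mk _) = _
  rw [PowerSeries.coeff_mk, primcCount_eq_ncard]
  congr 2
  ext g
  have hiff : primcWeight (fun v => if v = Var.q then Finsupp.single () 1 else 0) g =
      Finsupp.single () n ↔ (g.map primcDilation).sum = n := by
    rw [Finsupp.ext_iff]
    simp [primcWeight_apply]
  simp only [Set.mem_ofPred_eq, hiff]

theorem hasSum_ncard_fibre {α β : Type} {S : Set α} (hS : S.Finite) (f : α → β) :
    HasSum (fun b => {x ∈ S | f x = b}.ncard) S.ncard := by
  classical
  obtain ⟨s, rfl⟩ := hS.exists_finset_coe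
  have hfib : ∀ b, {x ∈ (s : Set α) | f x = b}.ncard = (s.filter fun x => f x = b).card := by
    intro b
    rw [← Set.ncard_coe_finset, Finset.coe_filter]
    rfl
  simp only [hfib]
  rw [Set.ncard_coe_finset, Finset.card_eq_sum_card_image f s]
  refine hasSum_sum_of_ne_finset_zero fun b hb => ?_
  rw [Finset.card_eq_zero, Finset.filter_eq_empty_iff]
  rintro x hx rfl
  exact hb (Finset.mem_image_of_mem f hx)

theorem hasSum_A₂ (n : ℕ) :
    HasSum (fun v : ℕ × ℕ × ℕ => A₂ n v.1 v.2.1 v.2.2) (primcCount n) := by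
  simp only [A₂_eq_ncard, primcCount_eq_ncard]
  refine hasSum_ncard_fibre ?_ primcStats
  have hfin := finiteFibres_primcLists
    (ε := fun v => if v = Var.q then Finsupp.single () 1 else 0) (by simp) (Finsupp.single () n)
  refine hfin.subset fun g hg => ⟨hg.1, Finsupp.ext fun _ => ?_⟩
  simp [primcWeight_apply, hg.2]

end Dilation

end PrimcRefined

namespace PrimcRefined

open Filter Topology

/-! ### The partitions counted by `B₂` -/

section CongruencePartitions

/-- The partitions counted by `B₂` with all parts in `S`. -/
def congruencePartitions (S : Set (ℕ × Colour)) : Set (Multiset (ℕ × Colour)) :=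
  {p | IsColouredPartition p ∧ ((p.map Prod.fst).filter (fun s => Odd s)).Nodup ∧
    (∀ x ∈ p, x.2 = Colour.green → x.1 % 4 = 2) ∧ ∀ x ∈ p, x ∈ S}

variable {S : Set (ℕ × Colour)} {x : ℕ × Colour}

theorem cons_mem_congruencePartitions_of_even (hx : 0 < x.1) (hx2 : Even x.1)
    (hgr : x.2 = Colour.green → x.1 % 4 = 2) (p : Multiset (ℕ × Colour)) :
    x ::ₘ p ∈ congruencePartitions S ↔ x ∈ S ∧ p ∈ congruencePartitions S := by
  have : ¬Odd x.1 := Nat.not_odd_iff_even.2 hx2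
  simp only [congruencePartitions, IsColouredPartition, Set.mem_ofPred_eq, Multiset.mem_cons,
    forall_eq_or_imp, Multiset.map_cons, this, not_false_eq_true, Multiset.filter_cons_of_neg]
  tauto

theorem cons_mem_congruencePartitions_of_odd (hx2 : Odd x.1)
    (hgr : x.2 ≠ Colour.green) (p : Multiset (ℕ × Colour)) :
    x ::ₘ p ∈ congruencePartitions S ↔
      x ∈ S ∧ p ∈ congruencePartitions S ∧ ∀ y ∈ p, y.1 ≠ x.1 := by
  have hx : 0 < x.1 := hx2.pos
  have : x.1 ∉ (p.map Prod.fst).filter (fun s => Odd s) ↔ ∀ y ∈ p, y.1 ≠ x.1 := by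
    rw [Multiset.mem_filter, Multiset.mem_map]
    grind
  simp only [congruencePartitions, IsColouredPartition, Set.mem_ofPred_eq, Multiset.mem_cons,
    forall_eq_or_imp, Multiset.map_cons, hx2, Multiset.filter_cons_of_pos, Multiset.nodup_cons,
    this]
  tauto

theorem congruencePartitions_mono {T : Set (ℕ × Colour)} (h : S ⊆ T) :
    congruencePartitions S ⊆ congruencePartitions T :=
  fun _ hp => ⟨hp.1, hp.2.1, hp.2.2.1, fun y hy => h (hp.2.2.2 y hy)⟩

theorem mem_congruencePartitions_of_insert {p : Multiset (ℕ × Colour)}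
    (hp : p ∈ congruencePartitions (insert x S)) (hx : x ∉ p) : p ∈ congruencePartitions S :=
  ⟨hp.1, hp.2.1, hp.2.2.1, fun y hy => (hp.2.2.2 y hy).resolve_left (by rintro rfl; exact hx hy)⟩

variable {σ : Type} (ε : Var → σ →₀ ℕ)

/-- The exponent of a part of a partition counted by `B₂`. -/
noncomputable def congruencePartWeight (x : ℕ × Colour) : σ →₀ ℕ :=
  x.1 • ε Var.q + ((if x.1 % 4 = 1 then ε Var.a else 0) +
    (if x.2 = Colour.green then ε Var.c else 0) + if x.1 % 4 = 3 then ε Var.d else 0)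

/-- The exponent of a partition counted by `B₂`. -/
noncomputable def congruenceWeight (p : Multiset (ℕ × Colour)) : σ →₀ ℕ :=
  (p.map (congruencePartWeight ε)).sum

variable {ε}

theorem size_smul_le_congruenceWeight (p : Multiset (ℕ × Colour)) :
    size p • ε Var.q ≤ congruenceWeight ε p := by
  induction p using Multiset.induction with
  | empty => simp [size, congruenceWeight]
  | cons x p ih =>
    simp only [size, congruenceWeight, Multiset.map_cons, Multiset.sum_cons, add_smul] at ih ⊢
    exact add_le_add le_self_add ih

instance : Finite Colour :=
  Finite.of_surjective (fun b : Bool => if b then Colour.red else Colour.green) fun c => by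
    cases c
    · exact ⟨true, rfl⟩
    · exact ⟨false, rfl⟩

theorem finiteFibres_congruencePartitions (hq : ε Var.q ≠ 0) :
    FiniteFibres (congruenceWeight ε) (congruencePartitions S) := by
  intro e
  obtain ⟨N, hN⟩ := exists_bound_of_smul_le hq e
  refine (finite_size_le (C := Colour) N).subset ?_
  rintro p ⟨hp, rfl⟩
  exact ⟨hp.1, hN _ (size_smul_le_congruenceWeight p)⟩

theorem congruenceWeight_cons (x : ℕ × Colour) (p : Multiset (ℕ × Colour)) :
    congruenceWeight ε (x ::ₘ p) = congruencePartWeight ε x + congruenceWeight ε p := by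
  simp [congruenceWeight]

/-- An even part may repeat freely: a partition either avoids `x` or is `x` added to an arbitrary
partition of the same kind, which gives a geometric series. -/
theorem setGF_insert_of_even (hq : ε Var.q ≠ 0) (hx : 0 < x.1) (hx2 : Even x.1)
    (hgr : x.2 = Colour.green → x.1 % 4 = 2) (hxS : x ∉ S) :
    (1 - MvPowerSeries.monomial (congruencePartWeight ε x) 1) *
        setGF (congruenceWeight ε) (congruencePartitions (insert x S)) =
      setGF (congruenceWeight ε) (congruencePartitions S) := by
  have hset : congruencePartitions (insert x S) =
      congruencePartitions S ∪ (x ::ₘ ·) '' congruencePartitions (insert x S) := by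
    ext p
    constructor
    · intro hp
      by_cases hxp : x ∈ p
      · obtain ⟨p, rfl⟩ := Multiset.exists_cons_of_mem hxp
        exact Or.inr ⟨p, ((cons_mem_congruencePartitions_of_even hx hx2 hgr p).1 hp).2, rfl⟩
      · exact Or.inl (mem_congruencePartitions_of_insert hp hxp)
    · rintro (hp | ⟨p, hp, rfl⟩)
      · exact congruencePartitions_mono (Set.subset_insert _ _) hp
      · exact (cons_mem_congruencePartitions_of_even hx hx2 hgr p).2 ⟨Set.mem_insert _ _, hp⟩
  have hfin : FiniteFibres (congruenceWeight ε) (congruencePartitions (insert x S)) :=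
    finiteFibres_congruencePartitions hq
  have h := setGF_union (wt := congruenceWeight ε) (S := congruencePartitions S)
    (T := (x ::ₘ ·) '' congruencePartitions (insert x S)) (by
      rw [Set.disjoint_left]
      rintro _ hp ⟨p, -, rfl⟩
      exact hxS (hp.2.2.2 x (Multiset.mem_cons_self x p)))
    (finiteFibres_congruencePartitions hq)
    (hfin.mono (Set.subset_union_right.trans hset.symm.subset))
  rw [← hset, setGF_image (congruencePartWeight ε x)
    (fun _ _ _ _ h => (Multiset.cons_inj_right x).1 h)
    (fun p _ => congruenceWeight_cons x p)] at h
  linear_combination h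

/-- An odd part occurs at most once. Distinctness concerns sizes regardless of colour, so `S` must
contain no part of that size at all. -/
theorem setGF_insert_of_odd (hq : ε Var.q ≠ 0) (hx2 : Odd x.1)
    (hgr : x.2 ≠ Colour.green) (hxS : ∀ y ∈ S, y.1 ≠ x.1) :
    setGF (congruenceWeight ε) (congruencePartitions (insert x S)) =
      (1 + MvPowerSeries.monomial (congruencePartWeight ε x) 1) *
        setGF (congruenceWeight ε) (congruencePartitions S) := by
  have hset : congruencePartitions (insert x S) =
      congruencePartitions S ∪ (x ::ₘ ·) '' congruencePartitions S := by
    ext p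
    constructor
    · intro hp
      by_cases hxp : x ∈ p
      · obtain ⟨p, rfl⟩ := Multiset.exists_cons_of_mem hxp
        obtain ⟨-, hp', hne⟩ := (cons_mem_congruencePartitions_of_odd hx2 hgr p).1 hp
        exact Or.inr ⟨p, mem_congruencePartitions_of_insert hp' fun h => hne x h rfl, rfl⟩
      · exact Or.inl (mem_congruencePartitions_of_insert hp hxp)
    · rintro (hp | ⟨p, hp, rfl⟩)
      · exact congruencePartitions_mono (Set.subset_insert _ _) hp
      · exact (cons_mem_congruencePartitions_of_odd hx2 hgr p).2 ⟨Set.mem_insert _ _,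
          congruencePartitions_mono (Set.subset_insert _ _) hp, fun y hy => hxS y (hp.2.2.2 y hy)⟩
  have hfin : FiniteFibres (congruenceWeight ε) (congruencePartitions (insert x S)) :=
    finiteFibres_congruencePartitions hq
  have h := setGF_union (wt := congruenceWeight ε) (S := congruencePartitions S)
    (T := (x ::ₘ ·) '' congruencePartitions S) (by
      rw [Set.disjoint_left]
      rintro _ hp ⟨p, -, rfl⟩
      exact hxS x (hp.2.2.2 x (Multiset.mem_cons_self x p)) rfl)
    (finiteFibres_congruencePartitions hq)
    (hfin.mono (Set.subset_union_right.trans hset.symm.subset))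
  rw [← hset, setGF_image (congruencePartWeight ε x)
    (fun _ _ _ _ h => (Multiset.cons_inj_right x).1 h)
    (fun p _ => congruenceWeight_cons x p)] at h
  linear_combination h

/-- The generating function of the partitions counted by `B₂` with parts at most `4 N`. -/
noncomputable def boundedCongruenceGF (ε : Var → σ →₀ ℕ) (N : ℕ) : MvPowerSeries σ ℤ :=
  setGF (congruenceWeight ε) (congruencePartitions {x | x.1 ≤ 4 * N})

theorem boundedCongruenceGF_zero : boundedCongruenceGF ε 0 = 1 := by
  rw [boundedCongruenceGF, ← setGF_singleton (wt := congruenceWeight ε) (x := 0) rfl]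
  congr 1
  ext p
  constructor
  · intro hp
    refine Multiset.eq_zero_of_forall_notMem fun x hx => ?_
    have h1 := hp.1 x hx
    have h2 : x.1 ≤ 4 * 0 := hp.2.2.2 x hx
    omega
  · rintro rfl
    simp [congruencePartitions, IsColouredPartition]

theorem boundedCongruenceGF_succ (hq : ε Var.q ≠ 0) (N : ℕ) :
    (1 - expVar ε .q ^ (4 * N + 4)) * ((1 - expVar ε .c * expVar ε .q ^ (4 * N + 2)) *
      ((1 - expVar ε .q ^ (4 * N + 2)) * boundedCongruenceGF ε (N + 1))) =
    (1 + expVar ε .d * expVar ε .q ^ (4 * N + 3)) *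
      ((1 + expVar ε .a * expVar ε .q ^ (4 * N + 1)) * boundedCongruenceGF ε N) := by
  let S : Set (ℕ × Colour) := {x | x.1 ≤ 4 * N}
  have hw : ∀ (n : ℕ) (c : Colour),
      MvPowerSeries.monomial (congruencePartWeight ε (n, c)) (1 : ℤ) =
      MvPowerSeries.monomial (ε .q) 1 ^ n * MvPowerSeries.monomial
        ((if n % 4 = 1 then ε Var.a else 0) +
        (if c = Colour.green then ε Var.c else 0) + if n % 4 = 3 then ε Var.d else 0) 1 :=
    fun n c => monomial_smul_add _ _ _
  have h1 := setGF_insert_of_odd (S := S) (x := (4 * N + 1, Colour.red)) hq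
    (by simp [parity_simps]) (by simp) (fun y (hy : y.1 ≤ 4 * N) => by grind)
  have h2 := setGF_insert_of_odd (S := insert (4 * N + 1, Colour.red) S)
    (x := (4 * N + 3, Colour.red)) hq (by simp [parity_simps]) (by simp) (by
      rintro y (rfl | hy)
      · simp
      · have : y.1 ≤ 4 * N := hy
        grind)
  have h3 := setGF_insert_of_even
    (S := insert (4 * N + 3, Colour.red) (insert (4 * N + 1, Colour.red) S))
    (x := (4 * N + 4, Colour.red)) hq (by simp) (by simp [parity_simps]) (by simp) (by simp [S])
  have h4 := setGF_insert_of_even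
    (S := insert (4 * N + 4, Colour.red)
      (insert (4 * N + 3, Colour.red) (insert (4 * N + 1, Colour.red) S)))
    (x := (4 * N + 2, Colour.green)) hq (by simp) (by simp [parity_simps])
    (by simp [Nat.add_mod]) (by simp [S])
  have h5 := setGF_insert_of_even
    (S := insert (4 * N + 2, Colour.green) (insert (4 * N + 4, Colour.red)
      (insert (4 * N + 3, Colour.red) (insert (4 * N + 1, Colour.red) S))))
    (x := (4 * N + 2, Colour.red)) hq (by simp) (by simp [parity_simps])
    (by simp) (by simp [S])
  -- The two sets of admissible parts differ, but only by green parts whose size is not 2 modulo 4,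
  -- and these never occur.
  have hset : congruencePartitions (insert (4 * N + 2, Colour.red) (insert (4 * N + 2, Colour.green)
      (insert (4 * N + 4, Colour.red) (insert (4 * N + 3, Colour.red)
        (insert (4 * N + 1, Colour.red) S))))) =
      congruencePartitions {x | x.1 ≤ 4 * (N + 1)} := by
    ext p
    refine and_congr_right fun hpos => and_congr_right fun _ => and_congr_right fun hgr =>
      forall₂_congr fun y hy => ?_
    have h1 := hgr y hy
    obtain ⟨s, c⟩ := y
    cases c <;> simp [S] at h1 ⊢ <;> omega
  rw [hset] at h5
  rw [hw] at h1 h2 h3 h4 h5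
  simp [Nat.add_mod, MvPowerSeries.monomial_zero_one] at h1 h2 h3 h4 h5
  rw [boundedCongruenceGF, boundedCongruenceGF]
  simp only [expVar]
  rw [h5, mul_comm (MvPowerSeries.monomial (ε Var.c) 1), h4, h3, h2, h1]
  ring

/-- Each block of four sizes contributes two red even parts, `4N + 2` and `4N + 4`, hence the
product of length `2 * N` beside those of length `N`. -/
theorem boundedCongruenceGF_eq (hq : ε Var.q ≠ 0) (N : ℕ) :
    boundedCongruenceGF ε N *
      ((∏ j ∈ Finset.range (2 * N), (1 - expVar ε .q ^ 2 * (expVar ε .q ^ 2) ^ j)) *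
        ∏ j ∈ Finset.range N, (1 - expVar ε .c * expVar ε .q ^ 2 * (expVar ε .q ^ 4) ^ j)) =
      (∏ j ∈ Finset.range N, (1 - -(expVar ε .a * expVar ε .q) * (expVar ε .q ^ 4) ^ j)) *
        ∏ j ∈ Finset.range N, (1 - -(expVar ε .d * expVar ε .q ^ 3) * (expVar ε .q ^ 4) ^ j) := by
  induction N with
  | zero => simp [boundedCongruenceGF_zero]
  | succ N ih =>
    rw [Nat.mul_add_one]
    simp only [Finset.prod_range_succ]
    have h := boundedCongruenceGF_succ hq N
    linear_combination
      (1 + expVar ε .d * expVar ε .q ^ (4 * N + 3)) *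
        (1 + expVar ε .a * expVar ε .q ^ (4 * N + 1)) * ih +
      (∏ j ∈ Finset.range (2 * N), (1 - expVar ε .q ^ 2 * (expVar ε .q ^ 2) ^ j)) *
        (∏ j ∈ Finset.range N, (1 - expVar ε .c * expVar ε .q ^ 2 * (expVar ε .q ^ 4) ^ j)) * h

theorem congruencePartitions_genFun (hq : ε Var.q ≠ 0) :
    setGF (congruenceWeight ε) (congruencePartitions Set.univ) *
        (qPochhammer (expVar ε .q ^ 2) (expVar ε .q ^ 2) *
          qPochhammer (expVar ε .c * expVar ε .q ^ 2) (expVar ε .q ^ 4)) =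
      qPochhammer (-(expVar ε .a * expVar ε .q)) (expVar ε .q ^ 4) *
        qPochhammer (-(expVar ε .d * expVar ε .q ^ 3)) (expVar ε .q ^ 4) := by
  have hc := constantCoeff_expVar hq
  have h2 : MvPowerSeries.constantCoeff (expVar ε .q ^ 2) = 0 := by simp [hc]
  have h4 : MvPowerSeries.constantCoeff (expVar ε .q ^ 4) = 0 := by simp [hc]
  have hlim : Tendsto (boundedCongruenceGF ε) atTop
      (𝓝 (setGF (congruenceWeight ε) (congruencePartitions Set.univ))) := by
    refine tendsto_setGF fun e => ?_
    obtain ⟨N, hN⟩ := exists_bound_of_smul_le hq e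
    filter_upwards [eventually_ge_atTop N] with n hn p hp
    refine ⟨fun h => congruencePartitions_mono (Set.subset_univ _) h,
      fun h => ⟨h.1, h.2.1, h.2.2.1, fun y hy => ?_⟩⟩
    have h1 : size p ≤ N := hN _ (hp ▸ size_smul_le_congruenceWeight p)
    have h2 : y.1 ≤ size p := Multiset.single_le_sum (fun _ _ => Nat.zero_le _) _
      (Multiset.mem_map_of_mem Prod.fst hy)
    change y.1 ≤ 4 * n
    omega
  refine tendsto_nhds_unique ((hlim.mul (((tendsto_prod_qPochhammer _ h2).comp
    (tendsto_id.const_mul_atTop' two_pos)).mul (tendsto_prod_qPochhammer _ h4))).congr fun N => ?_)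
    ((tendsto_prod_qPochhammer _ h4).mul (tendsto_prod_qPochhammer _ h4))
  exact boundedCongruenceGF_eq hq N

theorem congruenceWeight_apply (ε : Var → σ →₀ ℕ) (p : Multiset (ℕ × Colour)) (v : σ) :
    congruenceWeight ε p v = size p * ε Var.q v +
      p.countP (fun x => x.1 % 4 = 1) * ε Var.a v +
        p.countP (fun x => x.2 = Colour.green) * ε Var.c v +
          p.countP (fun x => x.1 % 4 = 3) * ε Var.d v := by
  induction p using Multiset.induction with
  | empty => simp [congruenceWeight, size]
  | cons x p ih =>
    rw [congruenceWeight_cons, Finsupp.add_apply, ih]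
    simp only [Multiset.countP_cons, size, Multiset.map_cons, Multiset.sum_cons,
      congruencePartWeight, Finsupp.add_apply, Finsupp.smul_apply, smul_eq_mul]
    split_ifs <;> try simp only [Finsupp.zero_apply, add_zero, zero_add]
    all_goals ring

theorem genFun_B₂ : genFun B₂ =
    setGF (congruenceWeight fun v => Finsupp.single v 1) (congruencePartitions Set.univ) := by
  ext e
  rw [coeff_setGF]
  change ((B₂ (e Var.q) (e Var.a) (e Var.c) (e Var.d) : ℕ) : ℤ) = _
  rw [B₂]
  congr 2
  ext p
  have hiff : congruenceWeight (fun v => Finsupp.single v 1) p = e ↔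
      size p = e Var.q ∧ p.countP (fun x => x.1 % 4 = 1) = e Var.a ∧
        p.countP (fun x => x.2 = Colour.green) = e Var.c ∧
          p.countP (fun x => x.1 % 4 = 3) = e Var.d := by
    rw [Finsupp.ext_iff]
    constructor
    · intro h
      have hq := h Var.q
      have ha := h Var.a
      have hc := h Var.c
      have hd := h Var.d
      rw [congruenceWeight_apply] at hq ha hc hd
      simp at hq ha hc hd
      exact ⟨hq, ha, hc, hd⟩
    · rintro ⟨hq, ha, hc, hd⟩ v
      rw [congruenceWeight_apply, hq, ha, hc, hd]
      cases v <;> simp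
  simp only [Set.mem_ofPred_eq, hiff, congruencePartitions, Set.mem_univ, implies_true]
  tauto

end CongruencePartitions

/-! ### Primc's product identity and the conclusion -/

theorem qPochhammer_primc {σ : Type} {q : MvPowerSeries σ ℤ}
    (hq : MvPowerSeries.constantCoeff q = 0) :
    qPochhammer (-q) (q ^ 4) * qPochhammer (-(q ^ 3)) (q ^ 4) * qPochhammer q q =
      qPochhammer (q ^ 2) (q ^ 2) * qPochhammer (q ^ 2) (q ^ 4) := by
  have hq2 : MvPowerSeries.constantCoeff (q ^ 2) = 0 := by simp [hq]
  -- The three facts are `(-q; q^4)(-q^3; q^4) = (-q; q^2)`, `(q; q^2)(q^2; q^2) = (q; q)` and `(q;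
  -- q^2)(-q; q^2) = (q^2; q^4)`, all infinite products.
  have h1 := qPochhammer_sq_mul_qPochhammer_sq (-q) hq2
  have h2 := qPochhammer_sq_mul_qPochhammer_sq q hq
  have h3 := qPochhammer_mul_qPochhammer_neg q hq2
  rw [show (q ^ 2) ^ 2 = q ^ 4 by ring] at h1 h3
  rw [show -q * q ^ 2 = -(q ^ 3) by ring] at h1
  rw [show q * q = q ^ 2 by ring] at h2
  rw [h1, ← h2, ← h3]
  ring

end PrimcRefined

theorem mainTheorem2 :
    -- the four-variable generating function of `A₂`, in `ℤ⟦q, a, c, d⟧`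
    (let q := var Var.q
     let a := var Var.a
     let c := var Var.c
     let d := var Var.d
     QPochhammerConverges (-(a * q)) (q ^ 4) ∧
     QPochhammerConverges (-(d * q ^ 3)) (q ^ 4) ∧
     QPochhammerConverges (q ^ 2) (q ^ 2) ∧
     QPochhammerConverges (c * q ^ 2) (q ^ 4) ∧
     IsUnit (qPochhammer (q ^ 2) (q ^ 2) * qPochhammer (c * q ^ 2) (q ^ 4)) ∧
     genFun A₂ =
       qPochhammer (-(a * q)) (q ^ 4) * qPochhammer (-(d * q ^ 3)) (q ^ 4) *
         Ring.inverse (qPochhammer (q ^ 2) (q ^ 2) * qPochhammer (c * q ^ 2) (q ^ 4))) ∧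
    -- equinumerosity
    (∀ n k l m : ℕ, A₂ n k l m = B₂ n k l m) ∧
    -- setting `a = c = d = 1`: Primc's identity, in `ℤ⟦q⟧`
    (∀ n : ℕ, HasSum (fun v : ℕ × ℕ × ℕ => A₂ n v.1 v.2.1 v.2.2) (primcCount n)) ∧
    (let q : PowerSeries ℤ := PowerSeries.X
     QPochhammerConverges (-q) (q ^ 4) ∧
     QPochhammerConverges (-(q ^ 3)) (q ^ 4) ∧
     QPochhammerConverges (q ^ 2) (q ^ 2) ∧
     QPochhammerConverges (q ^ 2) (q ^ 4) ∧
     QPochhammerConverges q q ∧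
     IsUnit (qPochhammer (q ^ 2) (q ^ 2) * qPochhammer (q ^ 2) (q ^ 4)) ∧
     IsUnit (qPochhammer q q) ∧
     qPochhammer (-q) (q ^ 4) * qPochhammer (-(q ^ 3)) (q ^ 4) *
         Ring.inverse (qPochhammer (q ^ 2) (q ^ 2) * qPochhammer (q ^ 2) (q ^ 4)) =
       Ring.inverse (qPochhammer q q) ∧
     PowerSeries.mk (fun n => (primcCount n : ℤ)) = Ring.inverse (qPochhammer q q)) := by
  have hε : Finsupp.single Var.q 1 ≠ 0 := by simp
  have hq : MvPowerSeries.constantCoeff (var Var.q) = 0 :=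
    constantCoeff_expVar (ε := fun v => Finsupp.single v 1) hε
  have h2 : MvPowerSeries.constantCoeff (var Var.q ^ 2) = 0 := by simp [hq]
  have h4 : MvPowerSeries.constantCoeff (var Var.q ^ 4) = 0 := by simp [hq]
  have hden : IsUnit (qPochhammer (var Var.q ^ 2) (var Var.q ^ 2) *
      qPochhammer (var Var.c * var Var.q ^ 2) (var Var.q ^ 4)) :=
    (isUnit_qPochhammer h2 h2).mul (isUnit_qPochhammer (by simp [hq]) h4)
  have hA := primcLists_genFun (ε := fun v => Finsupp.single v 1) hε
  have hB := congruencePartitions_genFun (ε := fun v => Finsupp.single v 1) hε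
  rw [← genFun_A₂] at hA
  rw [← genFun_B₂] at hB
  refine ⟨⟨qPochhammerConverges_of_constantCoeff _ h4, qPochhammerConverges_of_constantCoeff _ h4,
    qPochhammerConverges_of_constantCoeff _ h2, qPochhammerConverges_of_constantCoeff _ h4,
    hden, (Ring.eq_mul_inverse_iff_mul_eq _ _ _ hden).2 hA⟩, fun n k l m => ?_, hasSum_A₂, ?_⟩
  · have hAB : genFun A₂ = genFun B₂ := hden.mul_right_cancel (hA.trans hB.symm)
    have := congrFun hAB (Finsupp.single Var.q n + Finsupp.single Var.a k +
      Finsupp.single Var.c l + Finsupp.single Var.d m)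
    simpa [genFun] using this
  · intro q
    have hε' : (if Var.q = Var.q then Finsupp.single () 1 else 0 : Unit →₀ ℕ) ≠ 0 := by simp
    have hP := primcLists_genFun
      (ε := fun v => if v = Var.q then Finsupp.single () 1 else 0) hε'
    have h1 : expVar (fun v => if v = Var.q then Finsupp.single () 1 else 0) Var.q = q := rfl
    have hv : ∀ v, v ≠ Var.q →
        expVar (fun v => if v = Var.q then Finsupp.single () 1 else (0 : Unit →₀ ℕ)) v = 1 := by
      intro v hv
      rw [expVar, if_neg hv, MvPowerSeries.monomial_zero_one]
    have hq : MvPowerSeries.constantCoeff (σ := Unit) (R := ℤ) q = 0 := h1 ▸ constantCoeff_expVar hε'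
    rw [← mk_primcCount, h1, hv Var.a (by simp), hv Var.c (by simp), hv Var.d (by simp), one_mul,
      one_mul, one_mul] at hP
    have h2 : MvPowerSeries.constantCoeff (σ := Unit) (R := ℤ) (q ^ 2) = 0 := by
      rw [map_pow, hq, zero_pow two_ne_zero]
    have h4 : MvPowerSeries.constantCoeff (σ := Unit) (R := ℤ) (q ^ 4) = 0 := by
      rw [map_pow, hq, zero_pow four_ne_zero]
    have hden : IsUnit (qPochhammer (q ^ 2) (q ^ 2) * qPochhammer (q ^ 2) (q ^ 4)) :=
      (isUnit_qPochhammer (σ := Unit) h2 h2).mul (isUnit_qPochhammer (σ := Unit) h2 h4)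
    have hqq : IsUnit (qPochhammer q q) := isUnit_qPochhammer (σ := Unit) hq hq
    have hnum : qPochhammer (-q) (q ^ 4) * qPochhammer (-(q ^ 3)) (q ^ 4) * qPochhammer q q =
      qPochhammer (q ^ 2) (q ^ 2) * qPochhammer (q ^ 2) (q ^ 4) := qPochhammer_primc (σ := Unit) hq
    have hprod : qPochhammer (-q) (q ^ 4) * qPochhammer (-(q ^ 3)) (q ^ 4) *
        Ring.inverse (qPochhammer (q ^ 2) (q ^ 2) * qPochhammer (q ^ 2) (q ^ 4)) =
          Ring.inverse (qPochhammer q q) := by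
      refine hqq.mul_right_cancel ?_
      rw [Ring.inverse_mul_cancel _ hqq, mul_right_comm, hnum, Ring.mul_inverse_cancel _ hden]
    exact ⟨qPochhammerConverges_of_constantCoeff (σ := Unit) _ h4,
      qPochhammerConverges_of_constantCoeff (σ := Unit) _ h4,
      qPochhammerConverges_of_constantCoeff (σ := Unit) _ h2,
      qPochhammerConverges_of_constantCoeff (σ := Unit) _ h4,
      qPochhammerConverges_of_constantCoeff (σ := Unit) _ hq, hden, hqq, hprod,
      ((Ring.eq_mul_inverse_iff_mul_eq _ _ _ hden).2 hP).trans hprod⟩
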